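/- Let $p>2$ be a prime and let $R$ be an integral domain of characteristic zero that is $p$-adically complete (and separated, $\bigcap_s p^sR=0$). Let $\sigma:R\to R$ be a Frobenius lift, i.e. a ring endomorphism with $\sigma(r)\equiv r^p \bmod p$ for all $r\in R$. Let $f\in R[x_1^{\pm1},\dots,x_n^{\pm1}]$ have Newton polytope $\Delta\subset\mathbb R^n$, and let $b$ be a vertex of $\Delta$ such that the coefficient of $f$ at $x^b$ is a unit in $R$. Let $f^\sigma$ be $f$ with $\sigma$ applied to its coefficients. Call a subset of $\Delta$ closed if it is a union of faces of $\Delta$ (of any dimension), and let $\mu\subseteq\Delta$ be an open set (one with closed complement in $\Delta$) such that $\mu_{\mathbb Z}=\mu\cap\mathbb Z^n$ is non-empty. For $m\ge1$ let $\beta_m=\beta_m(\mu)$ be the matrix with rows and columns indexed by $\mu_{\mathbb Z}$ and $$(\beta_m)_{u,v}=\text{the coefficient of }x^{mv-u}\text{ in }f^{m-1}.$$ We apply $\sigma$ and derivations of $R$ to matrices entry by entry, and write $\beta_m^\sigma=\sigma(\beta_m)$. Congruences of matrices are also meant entry by entry. For $g\in\{f,f^\sigma\}$ let $\Omega_g(\mu)$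 be the $R$-module of rational functions spanned by $\omega^{g}_{d,u}=(d-1)!\,x^u/g^d$ with $d\ge1$ an integer and $u\in d\mu\cap\mathbb Z^n$, and let $\widehat\Omega_g(\mu)=\varprojlim_s\Omega_g(\mu)/p^s\Omega_g(\mu)$. For $u\in\mu_{\mathbb Z}$ put $\omega_u=x^u/f$ and $\omega_u^\sigma=x^u/f^\sigma$. Let $\Omega_{\rm formal}$ be the $R$-module of formal Laurent series $\sum_k a_kx^k$, $a_k\in R$, supported on the integral points of the cone spanned by $\Delta-b$, and let $d\Omega_{\rm formal}$ be the $R$-span of all $x_i\frac{\partial}{\partial x_i}\omega$ with $\omega\in\Omega_{\rm formal}$, $1\le i\le n$. Formal expansion at $b$ maps $\Omega_g(\mu)$ and, by $p$-adic continuity, $\widehat\Omega_g(\mu)$ to $\Omega_{\rm formal}$. Let $U_g(\mu)\subseteq\widehat\Omega_g(\mu)$ be the submodule of the elements whose expansion lies in $d\Omega_{\rm formal}$, and let $Q_g(\mu)=\widehat\Omega_g(\mu)/U_g(\mu)$. The Cartier operator is $\mathscr C(\sum_k a_kx^k)=\sum_k a_{pk}x^k$, and a derivation $\delta$ of $R$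 acts on formal series coefficient by coefficient. Assume that the Hasse--Witt matrix $\beta_p(\mu)$ is invertible over $R$. Then: 1. $\beta_{p^s}(\mu)$ is invertible over $R$ for all $s\ge1$. 2. The classes of $\omega_u$, $u\in\mu_{\mathbb Z}$, form an $R$-basis of $Q_f(\mu)$, and the classes of $\omega^\sigma_u$, $u\in\mu_{\mathbb Z}$, form an $R$-basis of $Q_{f^\sigma}(\mu)$. The Cartier operator maps $\widehat\Omega_f(\mu)$ to $\widehat\Omega_{f^\sigma}(\mu)$ (via their expansions) and induces an $R$-linear map $\mathscr C:Q_f(\mu)\to Q_{f^\sigma}(\mu)$. Let $\Lambda_\sigma=(\lambda_{u,w})$ be the transpose of its matrix in these bases, that is, the matrix over $R$ with $$\mathscr C(\omega_u)\equiv\sum_{w\in\mu_{\mathbb Z}}\lambda_{u,w}\,\omega_w^\sigma \mod U_{f^\sigma}(\mu)\qquad(u\in\mu_{\mathbb Z}).$$ Then for all $m,s\ge1$ $$\beta_{mp^s}(\mu)\equiv\Lambda_\sigma\,\beta^\sigma_{mp^{s-1}}(\mu)\mod p^s,$$ and for all $s\ge1$ the matrix $\beta^\sigma_{p^{s-1}}(\mu)$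 is invertible over $R$ and $$\Lambda_\sigma\equiv\beta_{p^s}(\mu)\,\beta^\sigma_{p^{s-1}}(\mu)^{-1}\mod p^s.$$ 3. Every derivation $\delta$ of $R$ maps $\widehat\Omega_f(\mu)$ to itself (via expansions) and induces an additive map of $Q_f(\mu)$ to itself; there is a unique matrix $N_\delta=(\nu_{u,w})$ over $R$ with $$\delta(\omega_u)\equiv\sum_{w\in\mu_{\mathbb Z}}\nu_{u,w}\,\omega_w\mod U_f(\mu)\qquad(u\in\mu_{\mathbb Z}).$$ For all $m,s\ge1$ it satisfies $$\delta(\beta_{mp^s}(\mu))\equiv N_\delta\,\beta_{mp^s}(\mu)\mod p^s,$$ and for all $s\ge1$ $$N_\delta\equiv\delta(\beta_{p^s}(\mu))\,\beta_{p^s}(\mu)^{-1}\mod p^s.$$ -/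

import Mathlib

namespace UnitRoot

noncomputable section

/-- Laurent polynomials in `n` variables over `R`; `f.coeff k` is the coefficient of `x ^ k`. -/
abbrev Laurent (R : Type*) [CommRing R] (n : ℕ) : Type _ := AddMonoidAlgebra R (Fin n → ℤ)

/-- An integral point, seen in `ℝ ^ n`. -/
def toReal {n : ℕ} (k : Fin n → ℤ) : Fin n → ℝ := fun i => (k i : ℝ)

/-- The Newton polytope of a Laurent polynomial: the convex hull of its support. -/
def newton {R : Type*} [CommRing R] {n : ℕ} (f : Laurent R n) : Set (Fin n → ℝ) :=
  convexHull ℝ (toReal '' (f.coeff.support : Set (Fin n → ℤ)))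

/-- `b` is a vertex of the polytope `Δ`. -/
def IsVertex {n : ℕ} (Δ : Set (Fin n → ℝ)) (b : Fin n → ℤ) : Prop :=
  toReal b ∈ Set.extremePoints ℝ Δ

/-- `μ` is open in the topology on the polytope `Δ` whose closed sets are the unions of faces
(of any dimension) of `Δ`. -/
def IsFaceOpen {n : ℕ} (Δ μ : Set (Fin n → ℝ)) : Prop :=
  μ ⊆ Δ ∧ ∃ S : Set (Set (Fin n → ℝ)), (∀ F ∈ S, IsExposed ℝ Δ F) ∧ Δ \ μ = ⋃₀ S

theorem finite_lattice {R : Type*} [CommRing R] {n : ℕ} (f : Laurent R n)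
    (μ : Set (Fin n → ℝ)) : {k : Fin n → ℤ | toReal k ∈ newton f ∧ toReal k ∈ μ}.Finite := by
  have hK : IsCompact (newton f) :=
    ((f.coeff.support.finite_toSet).image toReal).isCompact_convexHull ℝ
  obtain ⟨r, hr⟩ := hK.isBounded.subset_closedBall 0
  refine Set.Finite.subset
    (Set.Finite.pi' (t := fun _ : Fin n => Set.Icc (-⌈r⌉) ⌈r⌉) fun _ => Set.finite_Icc _ _) ?_
  rintro k ⟨hk, -⟩ i
  have h1 : ‖toReal k‖ ≤ r := by simpa using hr hk
  have h2 : |(k i : ℝ)| ≤ r := (norm_le_pi_norm (toReal k) i).trans h1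
  have h3 : |(k i : ℝ)| ≤ (⌈r⌉ : ℝ) := h2.trans (Int.le_ceil r)
  have h4 : |k i| ≤ ⌈r⌉ := by exact_mod_cast h3
  exact abs_le.mp h4

/-- The finite set `μ ∩ ℤ ^ n` of integral points of a subset `μ` of the Newton polytope of `f`. -/
def lattice {R : Type*} [CommRing R] {n : ℕ} (f : Laurent R n) (μ : Set (Fin n → ℝ)) :
    Finset (Fin n → ℤ) :=
  (finite_lattice f μ).toFinset

theorem toReal_mem_of_lattice {R : Type*} [CommRing R] {n : ℕ} {f : Laurent R n}
    {μ : Set (Fin n → ℝ)} (u : lattice f μ) : toReal (u : Fin n → ℤ) ∈ μ :=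
  ((finite_lattice f μ).mem_toFinset.mp u.2).2

/-- The matrix `β_m(μ)` (for `m ≥ 1`), whose entry at `(u, v)` is the coefficient of
`x ^ (m v - u)` in `f ^ (m - 1)`. -/
def beta {R : Type*} [CommRing R] {n : ℕ} (f : Laurent R n) (μ : Set (Fin n → ℝ)) (m : ℕ) :
    Matrix (lattice f μ) (lattice f μ) R :=
  Matrix.of fun u v => (f ^ (m - 1)).coeff (m • (v : Fin n → ℤ) - (u : Fin n → ℤ))

/-- `f ^ σ`: the ring endomorphism `σ` applied to the coefficients of `f`. -/
def twist {R : Type*} [CommRing R] {n : ℕ} (σ : R →+* R) (f : Laurent R n) : Laurent R n :=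
  AddMonoidAlgebra.mapRingHom (Fin n → ℤ) σ f

/-- Congruence of matrices modulo `p ^ s`, entry by entry. -/
def MatCongr {R : Type*} [CommRing R] {ι : Type*} (p s : ℕ) (A B : Matrix ι ι R) : Prop :=
  ∀ u v, (p : R) ^ s ∣ A u v - B u v

/-- The module `Ω_formal` of formal Laurent series (given by their coefficient functions) that are
supported in the cone spanned by `Δ - b`. -/
def formal (R : Type*) [CommRing R] {n : ℕ} (Δ : Set (Fin n → ℝ)) (b : Fin n → ℤ) :
    Submodule R ((Fin n → ℤ) → R) where
  carrier := {F | ∀ k, F k ≠ 0 →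
    ∃ w ∈ Δ, ∃ t : ℝ, 0 ≤ t ∧ toReal k = t • (w - toReal b)}
  zero_mem' := fun k hk => absurd rfl hk
  add_mem' := by
    intro F G hF hG k hk
    by_cases h : F k = 0
    · exact hG k fun h' => hk (by simp [h, h'])
    · exact hF k h
  smul_mem' := by
    intro c F hF k hk
    exact hF k fun h => hk (by simp [h])

/-- The derivation `x_i ∂/∂x_i` on formal Laurent series. -/
def theta {R : Type*} [CommRing R] {n : ℕ} (i : Fin n) (F : (Fin n → ℤ) → R) :
    (Fin n → ℤ) → R :=
  fun k => (k i : R) * F k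

/-- The module `dΩ_formal` of formal derivatives: the span of all `x_i ∂ω/∂x_i` with
`ω ∈ Ω_formal`. -/
def dFormal (R : Type*) [CommRing R] {n : ℕ} (Δ : Set (Fin n → ℝ)) (b : Fin n → ℤ) :
    Submodule R ((Fin n → ℤ) → R) :=
  Submodule.span R {G | ∃ i : Fin n, ∃ F ∈ formal R Δ b, G = theta i F}

/-- The Cartier operator on formal Laurent series, `∑ a_k x ^ k ↦ ∑ a_{pk} x ^ k`. -/
def cartier {R : Type*} {n : ℕ} (p : ℕ) (F : (Fin n → ℤ) → R) : (Fin n → ℤ) → R :=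
  fun k => F (p • k)

/-- A derivation of `R`, applied to the coefficients of a formal Laurent series. -/
def connection {R : Type*} [CommRing R] {n : ℕ} (δ : Derivation ℤ R R) (F : (Fin n → ℤ) → R) :
    (Fin n → ℤ) → R :=
  fun k => δ (F k)

/-- The formal expansion at the vertex `b` of the rational function
`ω_(d, u) = (d - 1)! x ^ u / g ^ d` (`d ≥ 1`), where the coefficient `g_b` of `x ^ b` in `g` is a
unit. With `h = 1 - g / (g_b x ^ b)` one has `g = g_b x ^ b (1 - h)`, whence
`x ^ u / g ^ d = g_b ^ (-d) ∑_j (d + j - 1).choose j * x ^ (u - d b) * h ^ j`, and only finitely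
many `j` contribute to each monomial. -/
def omega {R : Type*} [CommRing R] {n : ℕ} (g : Laurent R n) (b : Fin n → ℤ) (d : ℕ)
    (u : Fin n → ℤ) : (Fin n → ℤ) → R :=
  fun k => ((d - 1).factorial : R) * Ring.inverse (g.coeff b) ^ d *
    ∑ᶠ j : ℕ, ((d + j - 1).choose j : R) *
      ((1 - AddMonoidAlgebra.single (-b) (Ring.inverse (g.coeff b)) * g) ^ j).coeff
        (k - u + d • b)

/-- The module `Ω_g(μ)`, spanned over `R` by the functions `ω_(d, u)` where `(d, u)` runs over the
nonzero integral points of the cone over `μ`. A rational function in it is represented by its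
formal expansion at `b`, which determines it. -/
def Omega {R : Type*} [CommRing R] {n : ℕ} (g : Laurent R n) (b : Fin n → ℤ)
    (μ : Set (Fin n → ℝ)) : Submodule R ((Fin n → ℤ) → R) :=
  Submodule.span R {F | ∃ (d : ℕ) (u : Fin n → ℤ), 0 < d ∧
    (∃ w ∈ μ, toReal u = (d : ℝ) • w) ∧ F = omega g b d u}

/-- The function `ω_u = x ^ u / g` with `u` an integral point of `μ`, as an element of `Ω_g(μ)`. -/
def omegaOne {R : Type*} [CommRing R] {n : ℕ} (g : Laurent R n) (b : Fin n → ℤ)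
    (μ : Set (Fin n → ℝ)) (u : Fin n → ℤ) (hu : toReal u ∈ μ) : Omega g b μ :=
  ⟨omega g b 1 u, Submodule.subset_span ⟨1, u, one_pos, ⟨toReal u, hu, by simp⟩, rfl⟩⟩

/-- The `p`-adic completion of `Ω_g(μ)`, the inverse limit of the `Ω_g(μ) / p ^ s Ω_g(μ)`. -/
abbrev OmegaHat {R : Type*} [CommRing R] {n : ℕ} (p : ℕ) (g : Laurent R n) (b : Fin n → ℤ)
    (μ : Set (Fin n → ℝ)) : Type _ :=
  AdicCompletion (Ideal.span {(p : R)}) (Omega g b μ)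

/-- The formal expansion of the elements of the completion of `Ω_g(μ)`: the extension of the
inclusion of `Ω_g(μ)` in the formal series, coefficient by coefficient, by `p`-adic continuity. -/
def toFormal {R : Type*} [CommRing R] {n : ℕ} (p : ℕ) [IsAdicComplete (Ideal.span {(p : R)}) R]
    (g : Laurent R n) (b : Fin n → ℤ) (μ : Set (Fin n → ℝ)) :
    OmegaHat p g b μ →ₗ[R] ((Fin n → ℤ) → R) :=
  LinearMap.pi fun k =>
    (AdicCompletion.ofLinearEquiv (Ideal.span {(p : R)}) R).symm.toLinearMap ∘ₗ
      (AdicCompletion.map (Ideal.span {(p : R)})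
        ((LinearMap.proj k : ((Fin n → ℤ) → R) →ₗ[R] R) ∘ₗ
          (Omega g b μ).subtype)).restrictScalars R

/-- The module `U_g(μ)` of those elements of the completion of `Ω_g(μ)` that are formal
derivatives. -/
def formalExact {R : Type*} [CommRing R] {n : ℕ} (p : ℕ)
    [IsAdicComplete (Ideal.span {(p : R)}) R] (Δ : Set (Fin n → ℝ)) (g : Laurent R n)
    (b : Fin n → ℤ) (μ : Set (Fin n → ℝ)) : Submodule R (OmegaHat p g b μ) :=
  (dFormal R Δ b).comap (toFormal p g b μ)

/-- The quotient `Q_g(μ)` of the completion of `Ω_g(μ)` by the formal derivatives. -/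
abbrev Crystal {R : Type*} [CommRing R] {n : ℕ} (p : ℕ)
    [IsAdicComplete (Ideal.span {(p : R)}) R] (Δ : Set (Fin n → ℝ)) (g : Laurent R n)
    (b : Fin n → ℤ) (μ : Set (Fin n → ℝ)) : Type _ :=
  OmegaHat p g b μ ⧸ formalExact p Δ g b μ

/-- The class in `Q_g(μ)` of an element of the completion of `Ω_g(μ)`. -/
def crystalMk {R : Type*} [CommRing R] {n : ℕ} (p : ℕ)
    [IsAdicComplete (Ideal.span {(p : R)}) R] (Δ : Set (Fin n → ℝ)) (g : Laurent R n)
    (b : Fin n → ℤ) (μ : Set (Fin n → ℝ)) :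
    OmegaHat p g b μ →ₗ[R] Crystal p Δ g b μ :=
  (formalExact p Δ g b μ).mkQ

/-- The class in `Q_g(μ)` of `ω_u = x ^ u / g`, for `u` an integral point of `μ`. -/
def omegaClass {R : Type*} [CommRing R] {n : ℕ} (p : ℕ)
    [IsAdicComplete (Ideal.span {(p : R)}) R] (Δ : Set (Fin n → ℝ)) (g : Laurent R n)
    (b : Fin n → ℤ) (μ : Set (Fin n → ℝ)) (u : Fin n → ℤ) (hu : toReal u ∈ μ) :
    Crystal p Δ g b μ :=
  crystalMk p Δ g b μ
    (AdicCompletion.of (Ideal.span {(p : R)}) (Omega g b μ) (omegaOne g b μ u hu))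

/-- A map `Φ : Q_g(μ) → Q_g'(μ)` is induced by an operator `T` on formal Laurent series: `T` maps
the completion of `Ω_g(μ)` to that of `Ω_g'(μ)`, and `Φ` is the map that it induces on the
quotients. This determines `Φ`. -/
def IsInducedBy {R : Type*} [CommRing R] {n : ℕ} (p : ℕ)
    [IsAdicComplete (Ideal.span {(p : R)}) R] (Δ : Set (Fin n → ℝ)) (g g' : Laurent R n)
    (b : Fin n → ℤ) (μ : Set (Fin n → ℝ)) (T : ((Fin n → ℤ) → R) → ((Fin n → ℤ) → R))
    (Φ : Crystal p Δ g b μ → Crystal p Δ g' b μ) : Prop :=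
  ∀ ω : OmegaHat p g b μ, ∃ η : OmegaHat p g' b μ,
    toFormal p g' b μ η = T (toFormal p g b μ ω) ∧
      Φ (crystalMk p Δ g b μ ω) = crystalMk p Δ g' b μ η

end

end UnitRoot

/-! Everything happens inside formal series. A linear functional that has its strict minimum on the
support of `f` at the vertex `b` makes multiplication by `f` injective on series bounded below, even
modulo `p ^ s` (`Leading.dvd_of_dvd_act`). So the expansion of a rational function is determined by
clearing its denominator (`act_omega`, `eq_omegaPoly`), and the completed modules can be replaced by
their images `hat` in the formal series.

Cartier operator: a Frobenius lift gives `g ^ p = g^σ(x ^ p) - p G`. Expanding negative powers of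
the right side in a binomial series writes the Cartier image of `ω_(d, u)` as a series of functions
with poles along `g^σ`, weighted by `p ^ j / j!`. For `p > 2` these weights tend to zero and are
divisible by `p` once `j ≥ 1`; poles of order `d > p` gain a factor `p` from the factorials. Hence
the image of `hat` lies in the span of the `ω_w^σ` plus `p` times the new `hat`
(`IsFrame.cartier_hat`), and on the `ω_u` the matrix modulo `p` is the Hasse–Witt matrix.

Decomposition: formal derivatives are the series `F` in `Ω_formal` with `p ^ s ∣ C ^ s F` for all
`s` (`mem_dFormal_iff`). If Hasse–Witt is invertible, `C F` can be matched modulo `p` by `C` of a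
combination of the `ω_u`. Iterating, `F` minus a suitable combination has its `C ^ s` divisible by
`p ^ s`. Invertibility also makes `C ^ s` injective modulo `p` on combinations, so these converge to
a unique limit, and the `ω_u` form a basis of the quotient.

Congruences: the functional "coefficient of `x ^ (m v)` in `g ^ m F`" (`period`) sends `ω_u` to the
entry of `β_m`. As `g ^ (m p ^ s)` is congruent to `g^σ(x ^ p) ^ (m p ^ (s - 1))` modulo `p ^ s`,
the period of `F` at `m p ^ s` is that of `C F` at `m p ^ (s - 1)`, modulo `p ^ s`; iterating,
derivatives have periods divisible by `p ^ s`. Taking periods of `C ω_u = ∑ λ ω^σ + p · derivative`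
gives the congruence for `Λ`, the extra `p` making up for the level lost. A derivation of `R`
commutes with periods modulo `p ^ s`, since `δ (g ^ (m p ^ s))` is divisible by `p ^ s`; this gives
the congruence for `N_δ`. -/

namespace UnitRoot

noncomputable section

/-! ### Laurent polynomials acting on formal series -/

section Action

variable {R : Type*} [CommRing R] {n : ℕ}

/-- Multiplication of formal series by monomials. -/
def shift (R : Type*) [CommRing R] (n : ℕ) :
    Multiplicative (Fin n → ℤ) →* Module.End R ((Fin n → ℤ) → R) where
  toFun a :=
    { toFun := fun F k => F (k - a.toAdd)
      map_add' := fun _ _ => rfl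
      map_smul' := fun _ _ => rfl }
  map_one' := by
    ext F k
    simp
  map_mul' a c := by
    refine LinearMap.ext fun F => funext fun k => ?_
    simp [sub_sub]

/-- Multiplication of formal series by Laurent polynomials. -/
def act : Laurent R n →ₐ[R] Module.End R ((Fin n → ℤ) → R) :=
  AddMonoidAlgebra.lift R (Module.End R ((Fin n → ℤ) → R)) (Fin n → ℤ) (shift R n)

theorem act_single (a : Fin n → ℤ) (r : R) (F : (Fin n → ℤ) → R) (k : Fin n → ℤ) :
    act (AddMonoidAlgebra.single a r) F k = r * F (k - a) := by
  simp [act, shift]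

theorem act_apply (P : Laurent R n) (F : (Fin n → ℤ) → R) (k : Fin n → ℤ) :
    act P F k = ∑ a ∈ P.coeff.support, P.coeff a * F (k - a) := by
  rw [act, AddMonoidAlgebra.lift_apply, Finsupp.sum, LinearMap.sum_apply, Finset.sum_apply]
  simp [shift]

theorem act_mul (P Q : Laurent R n) (F : (Fin n → ℤ) → R) :
    act (P * Q) F = act P (act Q F) := by
  rw [map_mul]
  rfl

theorem act_comm (P Q : Laurent R n) (F : (Fin n → ℤ) → R) :
    act P (act Q F) = act Q (act P F) := by
  rw [← act_mul, mul_comm, act_mul]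

/-- A Laurent polynomial acts on another one by multiplication. -/
theorem act_coeff (P Q : Laurent R n) : act P ⇑Q.coeff = ⇑(P * Q).coeff := by
  induction P using AddMonoidAlgebra.induction_linear with
  | zero => simp
  | add P₁ P₂ h₁ h₂ => simp [add_mul, h₁, h₂]
  | single a r =>
    ext k
    rw [act_single, AddMonoidAlgebra.coeff_single_mul_apply, neg_add_eq_sub]

theorem dvd_act {q : R} (P : Laurent R n) {F : (Fin n → ℤ) → R} (hF : ∀ k, q ∣ F k)
    (k : Fin n → ℤ) : q ∣ act P F k := by
  rw [act_apply]
  exact Finset.dvd_sum fun a _ => (hF _).mul_left _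

/-- The support of `F` is bounded below with respect to `l`. -/
def Low (l : (Fin n → ℤ) →+ ℝ) (F : (Fin n → ℤ) → R) : Prop :=
  ∃ c : ℝ, ∀ k, F k ≠ 0 → c ≤ l k

theorem low_coeff (l : (Fin n → ℤ) →+ ℝ) (P : Laurent R n) : Low l ⇑P.coeff := by
  obtain ⟨c, hc⟩ := (P.coeff.support.image l).finite_toSet.bddBelow
  refine ⟨c, fun k hk => hc ?_⟩
  simpa using ⟨k, hk, rfl⟩

theorem Low.act {l : (Fin n → ℤ) →+ ℝ} {F : (Fin n → ℤ) → R} (hF : Low l F)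
    (P : Laurent R n) : Low l (act P F) := by
  obtain ⟨c, hc⟩ := hF
  obtain ⟨c', hc'⟩ := low_coeff l P
  refine ⟨c + c', fun k hk => ?_⟩
  rw [act_apply] at hk
  obtain ⟨a, -, ha⟩ := Finset.exists_ne_zero_of_sum_ne_zero hk
  have h1 := hc' a (left_ne_zero_of_mul ha)
  have h2 := hc _ (right_ne_zero_of_mul ha)
  rw [map_sub] at h2
  linarith

theorem Low.add {l : (Fin n → ℤ) →+ ℝ} {F G : (Fin n → ℤ) → R} (hF : Low l F)
    (hG : Low l G) : Low l (F + G) := by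
  obtain ⟨c, hc⟩ := hF
  obtain ⟨c', hc'⟩ := hG
  refine ⟨min c c', fun k hk => ?_⟩
  by_cases h : F k = 0
  · exact (min_le_right _ _).trans (hc' k fun h' => hk (by simp [h, h']))
  · exact (min_le_left _ _).trans (hc k h)

theorem Low.smul {l : (Fin n → ℤ) →+ ℝ} {F : (Fin n → ℤ) → R} (hF : Low l F) (r : R) :
    Low l (r • F) := by
  obtain ⟨c, hc⟩ := hF
  exact ⟨c, fun k hk => hc k fun h => hk (by simp [h])⟩

theorem Low.sub {l : (Fin n → ℤ) →+ ℝ} {F G : (Fin n → ℤ) → R} (hF : Low l F)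
    (hG : Low l G) : Low l (F - G) := by
  have := hF.add (hG.smul (-1))
  rwa [neg_one_smul, ← sub_eq_add_neg] at this

theorem low_zero (l : (Fin n → ℤ) →+ ℝ) : Low l (0 : (Fin n → ℤ) → R) :=
  ⟨0, fun _ hk => absurd rfl hk⟩

theorem low_sum {ι : Type*} {l : (Fin n → ℤ) →+ ℝ} (s : Finset ι)
    {F : ι → (Fin n → ℤ) → R} (hF : ∀ i ∈ s, Low l (F i)) : Low l (∑ i ∈ s, F i) := by
  classical
  induction s using Finset.induction_on with
  | empty => simpa using low_zero l
  | insert i s hi ih =>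
    rw [Finset.sum_insert hi]
    exact (hF i (by simp)).add (ih fun j hj => hF j (by simp [hj]))

/-- The monomial `x ^ b` occurs in `g` with a unit coefficient, and is its only monomial of minimal
weight with respect to `l`. -/
def Leading (l : (Fin n → ℤ) →+ ℝ) (b : Fin n → ℤ) (g : Laurent R n) : Prop :=
  IsUnit (g.coeff b) ∧ ∀ a ∈ g.coeff.support, a ≠ b → l b + 1 ≤ l a

/-- The coefficient of `g F` at `k + b` is `g_b F k` plus terms `g_a F (k + b - a)` whose points
have weight at least 1 below that of `k`. Induct on the weight, starting below the support of `F`.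
The case `q = 0` is injectivity. -/
theorem Leading.dvd_of_dvd_act {l : (Fin n → ℤ) →+ ℝ} {b : Fin n → ℤ} {g : Laurent R n}
    (hg : Leading l b g) {q : R} {F : (Fin n → ℤ) → R} (hF : Low l F)
    (h : ∀ k, q ∣ act g F k) (k : Fin n → ℤ) : q ∣ F k := by
  obtain ⟨c, hc⟩ := hF
  have key : ∀ (j : ℕ) (k : Fin n → ℤ), l k < c + j → q ∣ F k := by
    intro j
    induction j with
    | zero =>
      intro k hk
      have : F k = 0 := by
        by_contra h0
        have := hc k h0
        simp at hk
        linarith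
      simp [this]
    | succ j ih =>
      intro k hk
      push_cast at hk
      by_cases hb : b ∈ g.coeff.support
      · have h1 := h (k + b)
        rw [act_apply, ← Finset.add_sum_erase _ _ hb] at h1
        have h2 : q ∣ ∑ a ∈ g.coeff.support.erase b, g.coeff a * F (k + b - a) := by
          refine Finset.dvd_sum fun a ha => ?_
          obtain ⟨ha1, ha2⟩ := Finset.mem_erase.mp ha
          refine (ih _ ?_).mul_left _
          have := hg.2 a ha2 ha1
          rw [map_sub, map_add]
          linarith
        have h3 := (dvd_add_left h2).mp h1
        rw [add_sub_cancel_right] at h3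
        exact hg.1.dvd_mul_left.mp h3
      · have h0 : IsUnit (0 : R) := by
          have := hg.1
          rwa [Finsupp.notMem_support_iff.mp hb] at this
        have : Subsingleton R := isUnit_zero_iff.mp h0 |> fun h => subsingleton_of_zero_eq_one h
        rw [Subsingleton.elim (F k) 0]
        exact dvd_zero q
  obtain ⟨j, hj⟩ := exists_nat_gt (l k - c)
  exact key j k (by linarith)

theorem Leading.dvd_of_dvd_act_pow {l : (Fin n → ℤ) →+ ℝ} {b : Fin n → ℤ} {g : Laurent R n}
    (hg : Leading l b g) {q : R} (d : ℕ) : ∀ {F : (Fin n → ℤ) → R}, Low l F →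
    (∀ k, q ∣ act (g ^ d) F k) → ∀ k, q ∣ F k := by
  induction d with
  | zero => intro F _ h; simpa using h
  | succ d ih =>
    intro F hF h
    refine hg.dvd_of_dvd_act hF (ih (hF.act g) ?_)
    rwa [← act_mul, ← pow_succ]

theorem Leading.act_pow_injective {l : (Fin n → ℤ) →+ ℝ} {b : Fin n → ℤ} {g : Laurent R n}
    (hg : Leading l b g) (d : ℕ) {F G : (Fin n → ℤ) → R} (hF : Low l F) (hG : Low l G)
    (h : act (g ^ d) F = act (g ^ d) G) : F = G := by
  have := hg.dvd_of_dvd_act_pow (q := 0) d (hF.sub hG) (by intro k; rw [map_sub, h]; simp)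
  ext k
  simpa [sub_eq_zero] using this k

end Action

/-! ### Expansion of rational functions at the vertex -/

section Expansion

variable {R : Type*} [CommRing R] {n : ℕ}

/-- The series `1 - g / (g_b x ^ b)`. -/
def rest (g : Laurent R n) (b : Fin n → ℤ) : Laurent R n :=
  1 - AddMonoidAlgebra.single (-b) (Ring.inverse (g.coeff b)) * g

theorem rest_coeff (g : Laurent R n) (b k : Fin n → ℤ) :
    (rest g b).coeff k = (if k = 0 then 1 else 0) - Ring.inverse (g.coeff b) * g.coeff (k + b) := by
  classical
  rw [rest, AddMonoidAlgebra.coeff_sub, Finsupp.sub_apply,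
    AddMonoidAlgebra.coeff_single_mul_apply, AddMonoidAlgebra.one_def,
    AddMonoidAlgebra.coeff_single, Finsupp.single_apply]
  simp [eq_comm, add_comm]

theorem rest_support {g : Laurent R n} {b : Fin n → ℤ} (hb : IsUnit (g.coeff b))
    {k : Fin n → ℤ} (hk : (rest g b).coeff k ≠ 0) : k ≠ 0 ∧ g.coeff (k + b) ≠ 0 := by
  rw [rest_coeff] at hk
  have h0 : k ≠ 0 := by
    rintro rfl
    simp [Ring.inverse_mul_cancel _ hb] at hk
  refine ⟨h0, fun h => hk ?_⟩
  simp [h0, h]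

theorem exists_add_of_coeff_mul_ne_zero {P Q : Laurent R n} {k : Fin n → ℤ}
    (h : (P * Q).coeff k ≠ 0) : ∃ a c, a + c = k ∧ P.coeff a ≠ 0 ∧ Q.coeff c ≠ 0 := by
  rw [← act_coeff, act_apply] at h
  obtain ⟨a, -, ha⟩ := Finset.exists_ne_zero_of_sum_ne_zero h
  exact ⟨a, k - a, by abel, left_ne_zero_of_mul ha, right_ne_zero_of_mul ha⟩

theorem rest_pow_support {l : (Fin n → ℤ) →+ ℝ} {g : Laurent R n} {b : Fin n → ℤ}
    (hg : Leading l b g) (j : ℕ) {k : Fin n → ℤ} (hk : ((rest g b) ^ j).coeff k ≠ 0) :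
    (j : ℝ) ≤ l k := by
  induction j generalizing k with
  | zero =>
    rw [pow_zero, AddMonoidAlgebra.one_def, AddMonoidAlgebra.coeff_single] at hk
    have : k = 0 := by
      by_contra h
      exact hk (Finsupp.single_eq_of_ne h)
    simp [this]
  | succ j ih =>
    rw [pow_succ] at hk
    obtain ⟨a, c, rfl, ha, hc⟩ := exists_add_of_coeff_mul_ne_zero hk
    have h1 := ih ha
    obtain ⟨h2, h3⟩ := rest_support hg.1 hc
    have h4 := hg.2 (c + b) (Finsupp.mem_support_iff.mpr h3) (by simpa using h2)
    rw [map_add] at h4 ⊢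
    push_cast
    linarith

/-- The expansion of `(1 - h) ^ (-d)`, where `h = 1 - g / (g_b x ^ b)`. -/
def invPow (g : Laurent R n) (b : Fin n → ℤ) (d : ℕ) : (Fin n → ℤ) → R :=
  fun k => ∑ᶠ j : ℕ, ((d + j - 1).choose j : R) * ((rest g b) ^ j).coeff k

theorem invPow_eq_sum {l : (Fin n → ℤ) →+ ℝ} {g : Laurent R n} {b : Fin n → ℤ}
    (hg : Leading l b g) (d : ℕ) {k : Fin n → ℤ} {J : ℕ} (hJ : l k < J) :
    invPow g b d k =
      ∑ j ∈ Finset.range J, ((d + j - 1).choose j : R) * ((rest g b) ^ j).coeff k := by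
  refine finsum_eq_sum_of_support_subset _ fun j hj => ?_
  have h1 := rest_pow_support hg j (right_ne_zero_of_mul hj)
  have : (j : ℝ) < J := h1.trans_lt hJ
  simpa using this

theorem invPow_zero (g : Laurent R n) (b : Fin n → ℤ) :
    invPow g b 0 = ⇑(1 : Laurent R n).coeff := by
  ext k
  rw [invPow, finsum_eq_single _ 0]
  · simp
  · intro j hj
    -- For `d = 0` the binomial is `(j - 1).choose j`, which vanishes for `j > 0`; truncated
    -- subtraction makes it 1 at `j = 0`.
    rw [Nat.choose_eq_zero_of_lt (by omega)]
    simp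

/-- Pascal's rule, after telescoping `(1 - h) ∑ c_j h ^ j`. Only finitely many `j` reach a given
exponent, because `h ^ j` has weight at least `j`. -/
theorem act_rest_invPow {l : (Fin n → ℤ) →+ ℝ} {g : Laurent R n} {b : Fin n → ℤ}
    (hg : Leading l b g) (d : ℕ) :
    act (1 - rest g b) (invPow g b (d + 1)) = invPow g b d := by
  ext k
  obtain ⟨J, hJ⟩ := exists_nat_gt (l k)
  have h1 : act (rest g b) (invPow g b (d + 1)) k =
      ∑ j ∈ Finset.range J, ((d + j).choose j : R) * ((rest g b) ^ (j + 1)).coeff k := by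
    have h2 : ∀ j, ((rest g b) ^ (j + 1)).coeff k =
        ∑ a ∈ (rest g b).coeff.support, (rest g b).coeff a * ((rest g b) ^ j).coeff (k - a) := by
      intro j
      rw [pow_succ', ← act_coeff, act_apply]
    simp_rw [act_apply, h2, Finset.mul_sum]
    rw [Finset.sum_comm]
    refine Finset.sum_congr rfl fun a ha => ?_
    have h3 : l (k - a) < J := by
      have := rest_pow_support hg 1 (k := a) (by simpa using ha)
      rw [map_sub]
      simp at this
      linarith
    rw [invPow_eq_sum hg _ h3, Finset.mul_sum]
    refine Finset.sum_congr rfl fun j _ => ?_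
    rw [show d + 1 + j - 1 = d + j by omega]
    ring
  rw [map_sub, map_one, LinearMap.sub_apply, Pi.sub_apply, Module.End.one_apply, h1,
    invPow_eq_sum hg (d + 1) (J := J + 1) (by push_cast; linarith),
    invPow_eq_sum hg d (J := J + 1) (by push_cast; linarith),
    Finset.sum_range_succ', Finset.sum_range_succ' _ J, add_sub_right_comm,
    ← Finset.sum_sub_distrib]
  congr 1
  · refine Finset.sum_congr rfl fun j _ => ?_
    rw [show d + 1 + (j + 1) - 1 = (d + j) + 1 by omega, show d + (j + 1) - 1 = d + j by omega,
      Nat.choose_succ_succ]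
    push_cast
    ring
  · simp

theorem act_pow_invPow {l : (Fin n → ℤ) →+ ℝ} {g : Laurent R n} {b : Fin n → ℤ}
    (hg : Leading l b g) (d : ℕ) :
    act ((1 - rest g b) ^ d) (invPow g b d) = ⇑(1 : Laurent R n).coeff := by
  induction d with
  | zero => simp [invPow_zero]
  | succ d ih => rw [pow_succ, act_mul, act_rest_invPow hg, ih]

theorem low_invPow {l : (Fin n → ℤ) →+ ℝ} {g : Laurent R n} {b : Fin n → ℤ}
    (hg : Leading l b g) (d : ℕ) : Low l (invPow g b d) := by
  refine ⟨0, fun k hk => ?_⟩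
  obtain ⟨j, hj⟩ : ∃ j : ℕ, ((d + j - 1).choose j : R) * ((rest g b) ^ j).coeff k ≠ 0 := by
    by_contra! h
    exact hk (finsum_eq_zero_of_forall_eq_zero h)
  exact (Nat.cast_nonneg j).trans (rest_pow_support hg j (right_ne_zero_of_mul hj))

theorem omega_eq_act (g : Laurent R n) (b : Fin n → ℤ) (d : ℕ) (u : Fin n → ℤ) :
    omega g b d u = act (AddMonoidAlgebra.single (u - d • b)
      (((d - 1).factorial : R) * Ring.inverse (g.coeff b) ^ d)) (invPow g b d) := by
  ext k
  rw [act_single, omega, invPow, rest, sub_sub_eq_add_sub, sub_add_eq_add_sub]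

theorem low_omega {l : (Fin n → ℤ) →+ ℝ} {g : Laurent R n} {b : Fin n → ℤ}
    (hg : Leading l b g) (d : ℕ) (u : Fin n → ℤ) : Low l (omega g b d u) := by
  rw [omega_eq_act]
  exact (low_invPow hg d).act _

/-- The formal expansion `ω_(d, u)` is a solution of `g ^ d ω = (d - 1)! x ^ u`. -/
theorem act_omega {l : (Fin n → ℤ) →+ ℝ} {g : Laurent R n} {b : Fin n → ℤ}
    (hg : Leading l b g) (d : ℕ) (u : Fin n → ℤ) :
    act (g ^ d) (omega g b d u) =
      ⇑(AddMonoidAlgebra.single u ((d - 1).factorial : R) : Laurent R n).coeff := by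
  have h1 : g = AddMonoidAlgebra.single b (g.coeff b) * (1 - rest g b) := by
    rw [rest, sub_sub_cancel, ← mul_assoc, AddMonoidAlgebra.single_mul_single, add_neg_cancel,
      Ring.mul_inverse_cancel _ hg.1, ← AddMonoidAlgebra.one_def, one_mul]
  have h2 : g ^ d = (AddMonoidAlgebra.single b (g.coeff b)) ^ d * (1 - rest g b) ^ d := by
    rw [← mul_pow, ← h1]
  rw [omega_eq_act, act_comm, h2, act_mul, act_pow_invPow hg, AddMonoidAlgebra.single_pow,
    act_coeff, act_coeff, mul_one, AddMonoidAlgebra.single_mul_single, sub_add_cancel, mul_assoc,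
    ← mul_pow, Ring.inverse_mul_cancel _ hg.1, one_pow, mul_one]

end Expansion

/-! ### Cones, dilated polytopes and pole orders -/

section Polytope

variable {R : Type*} [CommRing R] {n : ℕ}

theorem toReal_add (a c : Fin n → ℤ) : toReal (a + c) = toReal a + toReal c := by
  ext i
  simp [toReal]

theorem toReal_sub (a c : Fin n → ℤ) : toReal (a - c) = toReal a - toReal c := by
  ext i
  simp [toReal]

theorem toReal_nsmul (m : ℕ) (a : Fin n → ℤ) : toReal (m • a) = (m : ℝ) • toReal a := by
  ext i
  simp [toReal]

/-- The integral point `u` lies in the dilation `d A`. -/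
def InDilate (A : Set (Fin n → ℝ)) (d : ℕ) (u : Fin n → ℤ) : Prop :=
  ∃ w ∈ A, toReal u = (d : ℝ) • w

/-- The integral point `k` lies in the cone spanned by `Δ - b`. -/
def InCone (Δ : Set (Fin n → ℝ)) (b k : Fin n → ℤ) : Prop :=
  ∃ w ∈ Δ, ∃ t : ℝ, 0 ≤ t ∧ toReal k = t • (w - toReal b)

/-- The convex set `Δ` contains the point `b`, on which the functional `l` is minimal, and `μ`
contains all open segments from a point of `μ` to a point of `Δ`. -/
structure IsFrame (Δ μ : Set (Fin n → ℝ)) (b : Fin n → ℤ) (l : (Fin n → ℤ) →+ ℝ) : Prop where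
  convex : Convex ℝ Δ
  vertex_mem : toReal b ∈ Δ
  subset : μ ⊆ Δ
  absorb : ∀ w ∈ μ, ∀ w' ∈ Δ, ∀ s t : ℝ, 0 < s → 0 ≤ t → s + t = 1 → s • w + t • w' ∈ μ
  nonneg : ∀ k, InCone Δ b k → 0 ≤ l k

/-- `g` has leading monomial `x ^ b` and its support is contained in `Δ`. -/
structure Adapted (Δ : Set (Fin n → ℝ)) (b : Fin n → ℤ) (l : (Fin n → ℤ) →+ ℝ)
    (g : Laurent R n) : Prop where
  leading : Leading l b g
  support : ∀ a, g.coeff a ≠ 0 → toReal a ∈ Δ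

variable {Δ μ : Set (Fin n → ℝ)} {b : Fin n → ℤ} {l : (Fin n → ℤ) →+ ℝ}

namespace IsFrame

variable (h : IsFrame Δ μ b l)
include h

/-- The sum is `d + m` times a convex combination of a point of `μ` and a point of `Δ`; the weight
on `μ` is positive because `d > 0`. This keeps numerators inside the dilates of `μ` when fractions
are multiplied out. -/
theorem absorb_dilate {d m : ℕ} (hd : 0 < d) {u a : Fin n → ℤ} (hu : InDilate μ d u)
    (ha : InDilate Δ m a) : InDilate μ (d + m) (u + a) := by
  obtain ⟨w, hw, hw'⟩ := hu
  obtain ⟨v, hv, hv'⟩ := ha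
  have hd' : (0 : ℝ) < d := Nat.cast_pos.mpr hd
  have hm : (0 : ℝ) ≤ m := Nat.cast_nonneg m
  have hdm : (0 : ℝ) < d + m := by linarith
  refine ⟨((d : ℝ) / (d + m)) • w + ((m : ℝ) / (d + m)) • v,
    h.absorb w hw v hv _ _ (by positivity) (by positivity) (by field_simp), ?_⟩
  rw [toReal_add, hw', hv', smul_add, smul_smul, smul_smul]
  push_cast
  rw [mul_div_cancel₀ _ hdm.ne', mul_div_cancel₀ _ hdm.ne']

theorem add_dilate {d m : ℕ} {u a : Fin n → ℤ} (hu : InDilate Δ d u)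
    (ha : InDilate Δ m a) : InDilate Δ (d + m) (u + a) := by
  obtain ⟨w, hw, hw'⟩ := hu
  obtain ⟨v, hv, hv'⟩ := ha
  rcases Nat.eq_zero_or_pos (d + m) with h0 | h0
  · obtain ⟨rfl, rfl⟩ : d = 0 ∧ m = 0 := by omega
    exact ⟨w, hw, by rw [toReal_add, hw', hv']; simp⟩
  · have hd : (0 : ℝ) ≤ d := Nat.cast_nonneg d
    have hm : (0 : ℝ) ≤ m := Nat.cast_nonneg m
    have hdm : (0 : ℝ) < d + m := by exact_mod_cast h0
    refine ⟨((d : ℝ) / (d + m)) • w + ((m : ℝ) / (d + m)) • v,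
      h.convex hw hv (by positivity) (by positivity) (by field_simp), ?_⟩
    rw [toReal_add, hw', hv', smul_add, smul_smul, smul_smul]
    push_cast
    rw [mul_div_cancel₀ _ hdm.ne', mul_div_cancel₀ _ hdm.ne']

theorem zero_dilate : InDilate Δ 0 (0 : Fin n → ℤ) := by
  refine ⟨_, h.vertex_mem, ?_⟩
  ext i
  simp [toReal]

theorem support_pow {g : Laurent R n} {m : ℕ} (hg : ∀ a, g.coeff a ≠ 0 → InDilate Δ m a)
    (j : ℕ) {a : Fin n → ℤ} (ha : (g ^ j).coeff a ≠ 0) : InDilate Δ (m * j) a := by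
  induction j generalizing a with
  | zero =>
    have : a = 0 := by
      by_contra h0
      rw [pow_zero, AddMonoidAlgebra.one_def, AddMonoidAlgebra.coeff_single] at ha
      exact ha (Finsupp.single_eq_of_ne h0)
    rw [this]
    exact h.zero_dilate
  | succ j ih =>
    rw [pow_succ] at ha
    obtain ⟨c, e, rfl, hc, he⟩ := exists_add_of_coeff_mul_ne_zero ha
    exact h.add_dilate (ih hc) (hg _ he)

theorem inCone_add {k k' : Fin n → ℤ} (hk : InCone Δ b k) (hk' : InCone Δ b k') :
    InCone Δ b (k + k') := by
  obtain ⟨w, hw, t, ht, e⟩ := hk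
  obtain ⟨w', hw', t', ht', e'⟩ := hk'
  rcases eq_or_lt_of_le (add_nonneg ht ht') with h0 | h0
  · have h1 : t = 0 := by linarith
    have h2 : t' = 0 := by linarith
    exact ⟨w, hw, 0, le_rfl, by rw [toReal_add, e, e', h1, h2]; simp⟩
  · refine ⟨(t / (t + t')) • w + (t' / (t + t')) • w',
      h.convex hw hw' (by positivity) (by positivity) (by field_simp), t + t', h0.le, ?_⟩
    simp only [toReal_add, e, e', smul_sub, smul_add, smul_smul, mul_div_cancel₀ _ h0.ne', add_smul]
    abel

theorem inCone_zero : InCone Δ b (0 : Fin n → ℤ) :=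
  ⟨_, h.vertex_mem, 0, le_rfl, by ext i; simp [toReal]⟩

theorem inCone_rest_pow {g : Laurent R n} (hg : Adapted Δ b l g) (j : ℕ) {k : Fin n → ℤ}
    (hk : ((rest g b) ^ j).coeff k ≠ 0) : InCone Δ b k := by
  induction j generalizing k with
  | zero =>
    have : k = 0 := by
      by_contra h0
      rw [pow_zero, AddMonoidAlgebra.one_def, AddMonoidAlgebra.coeff_single] at hk
      exact hk (Finsupp.single_eq_of_ne h0)
    rw [this]
    exact h.inCone_zero
  | succ j ih =>
    rw [pow_succ] at hk
    obtain ⟨c, e, rfl, hc, he⟩ := exists_add_of_coeff_mul_ne_zero hk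
    refine h.inCone_add (ih hc) ⟨_, hg.support _ (rest_support hg.leading.1 he).2, 1, zero_le_one,
      ?_⟩
    rw [toReal_add, add_sub_cancel_right, one_smul]

theorem omega_mem_formal {g : Laurent R n} (hg : Adapted Δ b l g) {d : ℕ} {u : Fin n → ℤ}
    (hu : InDilate Δ d u) : omega g b d u ∈ formal R Δ b := by
  intro k hk
  rw [omega_eq_act, act_single] at hk
  obtain ⟨j, hj⟩ : ∃ j : ℕ, ((d + j - 1).choose j : R) *
      ((rest g b) ^ j).coeff (k - (u - d • b)) ≠ 0 := by
    by_contra! h0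
    exact right_ne_zero_of_mul hk (finsum_eq_zero_of_forall_eq_zero h0)
  have h1 := h.inCone_rest_pow hg j (right_ne_zero_of_mul hj)
  obtain ⟨w, hw, e⟩ := hu
  have h2 : InCone Δ b (u - d • b) :=
    ⟨w, hw, d, Nat.cast_nonneg d, by rw [toReal_sub, toReal_nsmul, e, smul_sub]⟩
  have := h.inCone_add h1 h2
  rwa [sub_add_cancel] at this

theorem Omega_le_formal {g : Laurent R n} (hg : Adapted Δ b l g) :
    Omega g b μ ≤ formal R Δ b := by
  refine Submodule.span_le.mpr ?_
  rintro F ⟨d, u, -, ⟨w, hw, e⟩, rfl⟩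
  exact h.omega_mem_formal hg ⟨w, h.subset hw, e⟩

end IsFrame

/-- The combination `(d - 1)! P / g ^ d` of the functions `ω_(d, u)`. -/
def omegaPoly (g : Laurent R n) (b : Fin n → ℤ) (d : ℕ) (P : Laurent R n) : (Fin n → ℤ) → R :=
  ∑ u ∈ P.coeff.support, P.coeff u • omega g b d u

theorem omegaPoly_mem {g : Laurent R n} {d : ℕ} (hd : 0 < d) {P : Laurent R n}
    (hP : ∀ u, P.coeff u ≠ 0 → InDilate μ d u) : omegaPoly g b d P ∈ Omega g b μ :=
  Submodule.sum_mem _ fun u hu => Submodule.smul_mem _ _ <|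
    Submodule.subset_span ⟨d, u, hd, hP u (Finsupp.mem_support_iff.mp hu), rfl⟩

theorem low_omegaPoly {g : Laurent R n} (hg : Leading l b g) (d : ℕ) (P : Laurent R n) :
    Low l (omegaPoly g b d P) :=
  low_sum _ fun u _ => (low_omega hg d u).smul _

theorem act_omegaPoly {g : Laurent R n} (hg : Leading l b g) (d : ℕ) (P : Laurent R n) :
    act (g ^ d) (omegaPoly g b d P) = ((d - 1).factorial : R) • ⇑P.coeff := by
  rw [omegaPoly, map_sum]
  simp_rw [map_smul, act_omega hg]
  ext k
  classical
  rw [Finset.sum_apply, Pi.smul_apply, Finset.sum_eq_single k]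
  · simp [mul_comm]
  · intro u _ hu
    simp [hu]
  · intro hk
    simp [Finsupp.notMem_support_iff.mp hk]

/-- Clearing denominators is injective on series bounded below, so an identity of expansions may be
checked after multiplication by `g ^ d`. -/
theorem eq_omegaPoly {g : Laurent R n} (hg : Leading l b g) {d : ℕ} {P : Laurent R n}
    {F : (Fin n → ℤ) → R} (hF : Low l F)
    (h : act (g ^ d) F = ((d - 1).factorial : R) • ⇑P.coeff) : F = omegaPoly g b d P :=
  hg.act_pow_injective d hF (low_omegaPoly hg d P) (h.trans (act_omegaPoly hg d P).symm)

end Polytope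

/-! ### Limits and units in a `p`-adically complete ring -/

section Complete

variable {R : Type*} [CommRing R] (p : ℕ)

theorem mem_span_natCast_pow_smul_top {M : Type*} [AddCommGroup M] [Module R M] (N : ℕ) (x : M) :
    x ∈ (Ideal.span {(p : R)} ^ N • ⊤ : Submodule R M) ↔ ∃ z : M, x = (p : R) ^ N • z := by
  rw [Ideal.span_singleton_pow, Submodule.ideal_span_singleton_smul,
    Submodule.mem_smul_pointwise_iff_exists]
  constructor
  · rintro ⟨z, -, rfl⟩
    exact ⟨z, rfl⟩
  · rintro ⟨z, rfl⟩
    exact ⟨z, trivial, rfl⟩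

theorem smodEq_iff_dvd (N : ℕ) (x y : R) :
    x ≡ y [SMOD (Ideal.span {(p : R)} ^ N • ⊤ : Submodule R R)] ↔ (p : R) ^ N ∣ x - y := by
  rw [SModEq.sub_mem, mem_span_natCast_pow_smul_top]
  rfl

theorem dvd_sub_of_le {y : ℕ → R} (hy : ∀ N, (p : R) ^ N ∣ y (N + 1) - y N) {m N : ℕ}
    (h : m ≤ N) : (p : R) ^ m ∣ y N - y m := by
  induction N, h using Nat.le_induction with
  | base => simp
  | succ N hN ih =>
    rw [← sub_add_sub_cancel (y (N + 1)) (y N)]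
    exact dvd_add ((pow_dvd_pow _ hN).trans (hy N)) ih

variable [IsAdicComplete (Ideal.span {(p : R)}) R]

include p in
theorem eq_zero_of_forall_pow_dvd {r : R} (h : ∀ N : ℕ, (p : R) ^ N ∣ r) : r = 0 :=
  IsHausdorff.haus (I := Ideal.span {(p : R)}) inferInstance r fun N => by
    rw [smodEq_iff_dvd, sub_zero]
    exact h N

theorem exists_limit {y : ℕ → R} (hy : ∀ N, (p : R) ^ N ∣ y (N + 1) - y N) :
    ∃ r : R, ∀ N, (p : R) ^ N ∣ r - y N := by
  obtain ⟨r, hr⟩ := IsPrecomplete.prec (I := Ideal.span {(p : R)}) (M := R) inferInstance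
    (f := y) fun {m N} h => by
      rw [smodEq_iff_dvd, ← neg_sub, dvd_neg]
      exact dvd_sub_of_le p hy h
  refine ⟨r, fun N => ?_⟩
  rw [← neg_sub, dvd_neg, ← smodEq_iff_dvd]
  exact hr N

theorem exists_limit_pi {ι : Type*} {y : ℕ → ι → R}
    (hy : ∀ N k, (p : R) ^ N ∣ y (N + 1) k - y N k) :
    ∃ r : ι → R, ∀ N k, (p : R) ^ N ∣ r k - y N k := by
  choose r hr using fun k => exists_limit p (y := fun N => y N k) fun N => hy N k
  exact ⟨r, fun N k => hr k N⟩

/-- By completeness `p` lies in the Jacobson radical. -/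
theorem isUnit_of_dvd_sub {x y : R} (hx : IsUnit x) (h : (p : R) ∣ x - y) : IsUnit y := by
  have h1 : x - y ∈ (⊥ : Ideal R).jacobson :=
    IsAdicComplete.le_jacobson_bot (Ideal.span {(p : R)}) (Ideal.mem_span_singleton.mpr h)
  obtain ⟨u, rfl⟩ := hx
  have h2 := Ideal.mem_jacobson_bot.mp h1 (-(↑u⁻¹ : R))
  have h3 : ((u : R) - y) * -(↑u⁻¹ : R) + 1 = y * ↑u⁻¹ := by
    rw [mul_neg, sub_mul, Units.mul_inv]
    ring
  rw [h3] at h2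
  exact isUnit_of_mul_isUnit_left h2

theorem isUnit_natCast_of_coprime {m : ℕ} (h : Nat.Coprime m p) : IsUnit (m : R) := by
  obtain ⟨x, y, hxy⟩ := Nat.isCoprime_iff_coprime.mpr h
  have h1 : ((x * m : ℤ) : R) = 1 - y * p := by
    have := congrArg (fun z : ℤ => (z : R)) hxy
    push_cast at this ⊢
    linear_combination this
  have h2 : IsUnit ((x * m : ℤ) : R) :=
    isUnit_of_dvd_sub p isUnit_one (by rw [h1]; exact ⟨y, by ring⟩)
  push_cast at h2
  exact isUnit_of_mul_isUnit_right h2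

end Complete

/-! ### The image of the completion in formal series -/

section Hat

variable {R : Type*} [CommRing R] {n : ℕ} (p : ℕ)

/-- The limits of those sequences in `Ω_g(μ)` that are `p`-adically Cauchy in `Ω_g(μ)`. -/
def hat (g : Laurent R n) (b : Fin n → ℤ) (μ : Set (Fin n → ℝ)) :
    Submodule R ((Fin n → ℤ) → R) where
  carrier := {F | ∃ y z : ℕ → (Fin n → ℤ) → R, (∀ N, y N ∈ Omega g b μ) ∧
    (∀ N, z N ∈ Omega g b μ) ∧ (∀ N k, (p : R) ^ N ∣ F k - y N k) ∧
    ∀ N, y (N + 1) = y N + (p : R) ^ N • z N}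
  zero_mem' := ⟨0, 0, fun _ => zero_mem _, fun _ => zero_mem _, by simp, by simp⟩
  add_mem' := by
    rintro F F' ⟨y, z, hy, hz, hF, hyz⟩ ⟨y', z', hy', hz', hF', hyz'⟩
    refine ⟨y + y', z + z', fun N => add_mem (hy N) (hy' N), fun N => add_mem (hz N) (hz' N),
      fun N k => ?_, fun N => ?_⟩
    · rw [Pi.add_apply, Pi.add_apply, Pi.add_apply, add_sub_add_comm]
      exact dvd_add (hF N k) (hF' N k)
    · simp only [Pi.add_apply, hyz, hyz', smul_add]
      abel
  smul_mem' := by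
    rintro c F ⟨y, z, hy, hz, hF, hyz⟩
    refine ⟨c • y, c • z, fun N => Submodule.smul_mem _ c (hy N),
      fun N => Submodule.smul_mem _ c (hz N), fun N k => ?_, fun N => ?_⟩
    · simp only [Pi.smul_apply, smul_eq_mul, ← mul_sub]
      exact (hF N k).mul_left _
    · simp only [Pi.smul_apply, hyz, smul_add]
      rw [smul_comm]

variable {p} {g g' : Laurent R n} {b : Fin n → ℤ} {μ Δ : Set (Fin n → ℝ)}

theorem Omega_le_hat : Omega g b μ ≤ hat p g b μ := fun F hF =>
  ⟨fun _ => F, 0, fun _ => hF, fun _ => zero_mem _, by simp, by simp⟩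

theorem hat_le_formal [IsAdicComplete (Ideal.span {(p : R)}) R] (hΩ : Omega g b μ ≤ formal R Δ b) :
    hat p g b μ ≤ formal R Δ b := by
  rintro F ⟨y, z, hy, -, hF, -⟩ k hk
  by_contra h
  refine hk (eq_zero_of_forall_pow_dvd p fun N => ?_)
  have h1 : y N k = 0 := by
    by_contra h'
    exact h (hΩ (hy N) k h')
  simpa [h1] using hF N k

/-- A diagonal choice: the `N`-th approximation is the sum of `p ^ s` times the `N`-th approximant
of `E s` over `s < N`. Its increments are `p ^ N` times elements of `Ω` itself, which is stronger
than divisibility of coefficients and is what the completion requires. -/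
theorem mem_hat_of_series {F : (Fin n → ℤ) → R} {E : ℕ → (Fin n → ℤ) → R}
    (hE : ∀ s, E s ∈ hat p g b μ)
    (h : ∀ N k, (p : R) ^ N ∣ F k - ∑ s ∈ Finset.range N, (p : R) ^ s * E s k) :
    F ∈ hat p g b μ := by
  choose y z hy hz hF hyz using hE
  refine ⟨fun N => ∑ s ∈ Finset.range N, (p : R) ^ s • y s N,
    fun N => y N (N + 1) + ∑ s ∈ Finset.range N, (p : R) ^ s • z s N,
    fun N => Submodule.sum_mem _ fun s _ => Submodule.smul_mem _ _ (hy s N),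
    fun N => add_mem (hy N (N + 1)) (Submodule.sum_mem _ fun s _ => Submodule.smul_mem _ _ (hz s N)),
    fun N k => ?_, fun N => ?_⟩
  · dsimp only
    rw [← sub_add_sub_cancel _ (∑ s ∈ Finset.range N, (p : R) ^ s * E s k)]
    refine dvd_add (h N k) ?_
    rw [Finset.sum_apply, ← Finset.sum_sub_distrib]
    refine Finset.dvd_sum fun s _ => ?_
    rw [Pi.smul_apply, smul_eq_mul, ← mul_sub]
    exact (hF s N k).mul_left _
  · dsimp only
    rw [Finset.sum_range_succ, smul_add, Finset.smul_sum, add_comm _ (_ • y N (N + 1)),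
      add_left_comm, ← Finset.sum_add_distrib]
    congr 1
    refine Finset.sum_congr rfl fun s _ => ?_
    rw [hyz, smul_add, smul_comm]

theorem map_natCast_pow_smul (T : ((Fin n → ℤ) → R) →+ ((Fin n → ℤ) → R)) (N : ℕ)
    (F : (Fin n → ℤ) → R) : T ((p : R) ^ N • F) = (p : R) ^ N • T F := by
  rw [← Nat.cast_pow, Nat.cast_smul_eq_nsmul, Nat.cast_smul_eq_nsmul, map_nsmul]

theorem exists_eq_smul_of_dvd {q : R} {F : (Fin n → ℤ) → R} (h : ∀ k, q ∣ F k) :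
    ∃ F', F = q • F' := by
  choose F' hF' using h
  exact ⟨F', funext hF'⟩

theorem dvd_map_of_dvd (T : ((Fin n → ℤ) → R) →+ ((Fin n → ℤ) → R)) {N : ℕ}
    {F : (Fin n → ℤ) → R} (h : ∀ k, (p : R) ^ N ∣ F k) (k : Fin n → ℤ) :
    (p : R) ^ N ∣ T F k := by
  obtain ⟨F', rfl⟩ := exists_eq_smul_of_dvd h
  rw [map_natCast_pow_smul]
  exact dvd_mul_right _ _

/-- An additive map commutes with multiplication by `p ^ N`, hence with the series `∑ p ^ s z_s`
defining a limit. Linearity is not required, so this also covers derivations of the coefficients. -/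
theorem map_mem_hat (T : ((Fin n → ℤ) → R) →+ ((Fin n → ℤ) → R))
    (hT : ∀ w ∈ Omega g b μ, T w ∈ hat p g' b μ) {F : (Fin n → ℤ) → R}
    (hF : F ∈ hat p g b μ) : T F ∈ hat p g' b μ := by
  obtain ⟨y, z, hy, hz, hF, hyz⟩ := hF
  have h1 : T (F - y 0) ∈ hat p g' b μ := by
    refine mem_hat_of_series (E := fun s => T (z s)) (fun s => hT _ (hz s)) fun N k => ?_
    have h2 : ∀ N, y N = y 0 + ∑ s ∈ Finset.range N, (p : R) ^ s • z s := by
      intro N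
      induction N with
      | zero => simp
      | succ N ih => rw [hyz, ih, Finset.sum_range_succ, add_assoc]
    have h3 := dvd_map_of_dvd T (F := F - y N) (hF N) k
    rw [h2 N, ← sub_sub, map_sub, map_sum, Pi.sub_apply, Finset.sum_apply] at h3
    simpa only [map_natCast_pow_smul, Pi.smul_apply, smul_eq_mul] using h3
  have := add_mem h1 (hT _ (hy 0))
  rwa [← map_add, sub_add_cancel] at this

theorem natCast_ne_zero_of_prime [CharZero R] (hp : p.Prime) : (p : R) ≠ 0 :=
  Nat.cast_ne_zero.mpr hp.ne_zero

/-- After the approximant `y 1` all increments carry a factor `p`, which can be divided out termwise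
without leaving `Ω`. -/
theorem exists_add_smul_of_mem_hat [IsDomain R] [CharZero R] (hp : p.Prime)
    {F : (Fin n → ℤ) → R} (hF : F ∈ hat p g b μ) :
    ∃ w ∈ Omega g b μ, ∃ F' ∈ hat p g b μ, F = w + (p : R) • F' := by
  obtain ⟨y, z, hy, hz, hF, hyz⟩ := hF
  obtain ⟨F', hF'⟩ := exists_eq_smul_of_dvd (q := (p : R)) (F := F - y 1)
    (fun k => by simpa using hF 1 k)
  refine ⟨y 1, hy 1, F', ?_, by rw [← hF', add_sub_cancel]⟩
  refine mem_hat_of_series (E := fun s => z (s + 1)) (fun s => Omega_le_hat (hz _)) fun N k => ?_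
  have h2 : ∀ N, y (N + 1) = y 1 + (p : R) • ∑ s ∈ Finset.range N, (p : R) ^ s • z (s + 1) := by
    intro N
    induction N with
    | zero => simp
    | succ N ih => rw [hyz, ih, Finset.sum_range_succ, smul_add, add_assoc, smul_smul, ← pow_succ']
  have h3 := hF (N + 1) k
  rw [h2 N, Pi.add_apply, ← sub_sub, ← Pi.sub_apply, hF', Pi.smul_apply, Pi.smul_apply,
    ← smul_sub, smul_eq_mul, pow_succ', Finset.sum_apply] at h3
  exact (mul_dvd_mul_iff_left (natCast_ne_zero_of_prime hp)).mp h3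

end Hat

/-! ### The Frobenius lift and the Cartier operator -/

section Frobenius

variable {R : Type*} [CommRing R] {n : ℕ}

/-- The substitution `x ↦ x ^ p` on Laurent polynomials. -/
def frob (p : ℕ) : Laurent R n →+* Laurent R n :=
  AddMonoidAlgebra.mapDomainRingHom R (nsmulAddMonoidHom (α := Fin n → ℤ) p)

theorem frob_single (p : ℕ) (a : Fin n → ℤ) (r : R) :
    frob p (AddMonoidAlgebra.single a r) = AddMonoidAlgebra.single (p • a) r :=
  AddMonoidAlgebra.mapDomain_single

theorem exists_of_frob_coeff_ne_zero {p : ℕ} {P : Laurent R n} {a : Fin n → ℤ}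
    (h : (frob p P).coeff a ≠ 0) : ∃ c, P.coeff c ≠ 0 ∧ a = p • c := by
  classical
  have h1 : (frob p P).coeff = Finsupp.mapDomain (fun c : Fin n → ℤ => p • c) P.coeff := rfl
  rw [h1] at h
  have h2 := Finsupp.mapDomain_support (Finsupp.mem_support_iff.mpr h)
  obtain ⟨c, hc, rfl⟩ := Finset.mem_image.mp h2
  exact ⟨c, Finsupp.mem_support_iff.mp hc, rfl⟩

theorem twist_coeff (σ : R →+* R) (g : Laurent R n) (a : Fin n → ℤ) :
    (twist σ g).coeff a = σ (g.coeff a) :=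
  AddMonoidAlgebra.coeff_mapRingHom σ g a

theorem twist_pow (σ : R →+* R) (g : Laurent R n) (m : ℕ) :
    twist σ (g ^ m) = twist σ g ^ m :=
  map_pow _ _ _

/-- The Cartier operator as a linear map. -/
def cartierHom (R : Type*) [CommRing R] (n p : ℕ) :
    ((Fin n → ℤ) → R) →ₗ[R] ((Fin n → ℤ) → R) where
  toFun := cartier p
  map_add' _ _ := rfl
  map_smul' _ _ := rfl

theorem cartierHom_apply (p : ℕ) (F : (Fin n → ℤ) → R) (k : Fin n → ℤ) :
    cartierHom R n p F k = F (p • k) := rfl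

/-- The projection formula `C (P(x ^ p) F) = P C(F)`. -/
theorem cartierHom_act (p : ℕ) (P : Laurent R n) (F : (Fin n → ℤ) → R) :
    cartierHom R n p (act (frob p P) F) = act P (cartierHom R n p F) := by
  induction P using AddMonoidAlgebra.induction_linear with
  | zero => simp
  | add P₁ P₂ h₁ h₂ => simp [h₁, h₂]
  | single a r =>
    ext k
    rw [frob_single, cartierHom_apply, act_single, act_single, cartierHom_apply, smul_sub]

theorem nsmul_injective_of_pos {p : ℕ} (hp : 0 < p) :
    Function.Injective fun k : Fin n → ℤ => p • k := by
  intro k k' h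
  ext i
  have := congrFun h i
  simpa [hp.ne'] using this

/-- The Cartier operator on Laurent polynomials. -/
def cartierPoly (p : ℕ) (hp : 0 < p) (P : Laurent R n) : Laurent R n :=
  AddMonoidAlgebra.ofCoeff
    (P.coeff.comapDomain (fun k => p • k) (nsmul_injective_of_pos hp).injOn)

theorem cartierPoly_coeff (p : ℕ) (hp : 0 < p) (P : Laurent R n) :
    ⇑(cartierPoly p hp P).coeff = cartierHom R n p ⇑P.coeff := rfl

theorem low_cartier {l : (Fin n → ℤ) →+ ℝ} {p : ℕ} (hp : 0 < p) {F : (Fin n → ℤ) → R}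
    (hF : Low l F) : Low l (cartierHom R n p F) := by
  obtain ⟨c, hc⟩ := hF
  have hp' : (0 : ℝ) < p := Nat.cast_pos.mpr hp
  refine ⟨c / p, fun k hk => ?_⟩
  have := hc _ hk
  rw [map_nsmul, nsmul_eq_mul] at this
  rw [div_le_iff₀ hp']
  linarith

/-- A lift of Frobenius on `R` induces one on Laurent polynomials. -/
theorem natCast_dvd_pow_sub_frob {p : ℕ} (hp : p.Prime) {σ : R →+* R}
    (hσ : ∀ r : R, (p : R) ∣ σ r - r ^ p) (g : Laurent R n) :
    (p : Laurent R n) ∣ g ^ p - frob p (twist σ g) := by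
  induction g using AddMonoidAlgebra.induction_linear with
  | zero => simp [twist, hp.ne_zero]
  | add P Q hP hQ =>
    obtain ⟨r, hr⟩ := (Commute.all P Q).exists_add_pow_prime_eq hp
    have h1 : (P + Q) ^ p - frob p (twist σ (P + Q)) =
        (P ^ p - frob p (twist σ P)) + (Q ^ p - frob p (twist σ Q)) + p * (P * Q * r) := by
      rw [hr, twist, map_add, map_add]
      simp only [twist]
      ring
    rw [h1]
    exact dvd_add (dvd_add hP hQ) (dvd_mul_right _ _)
  | single a r =>
    obtain ⟨c, hc⟩ := hσ r
    rw [twist, AddMonoidAlgebra.mapRingHom_single, frob_single, AddMonoidAlgebra.single_pow,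
      ← AddMonoidAlgebra.single_sub]
    refine ⟨AddMonoidAlgebra.single (p • a) (-c), ?_⟩
    rw [AddMonoidAlgebra.natCast_def, AddMonoidAlgebra.single_mul_single, zero_add]
    congr 1
    linear_combination -hc

/-- Raising a congruence modulo `p` to the power `p ^ s` improves it to one modulo `p ^ (s + 1)`;
the further exponent `m` loses nothing. -/
theorem natCast_pow_dvd_pow_sub_frob {p : ℕ} (hp : p.Prime) {σ : R →+* R}
    (hσ : ∀ r : R, (p : R) ∣ σ r - r ^ p) (g : Laurent R n) (m s : ℕ) :
    ((p : Laurent R n)) ^ (s + 1) ∣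
      g ^ (m * p ^ (s + 1)) - frob p (twist σ g ^ (m * p ^ s)) := by
  have h1 := dvd_sub_pow_of_dvd_sub (natCast_dvd_pow_sub_frob hp hσ g) s
  have h2 := h1.trans (sub_dvd_pow_sub_pow _ _ m)
  rw [← pow_mul, ← pow_mul, ← pow_mul, ← map_pow] at h2
  rwa [show m * p ^ (s + 1) = p * (p ^ s * m) by ring, mul_comm m (p ^ s)]

theorem Adapted.twist {Δ : Set (Fin n → ℝ)} {b : Fin n → ℤ} {l : (Fin n → ℤ) →+ ℝ}
    {g : Laurent R n} (hg : Adapted Δ b l g) (σ : R →+* R) : Adapted Δ b l (twist σ g) where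
  leading := by
    refine ⟨?_, fun a ha => hg.leading.2 a ?_⟩
    · rw [twist_coeff]
      exact hg.leading.1.map σ
    · rw [Finsupp.mem_support_iff, twist_coeff] at ha
      exact Finsupp.mem_support_iff.mpr fun h => ha (by rw [h, map_zero])
  support a ha := by
    rw [twist_coeff] at ha
    exact hg.support a fun h => ha (by rw [h, map_zero])

end Frobenius

/-! ### A truncated binomial series -/

section Binomial

/-- The binomial series of `(A - Y) ^ (-k)`, truncated. -/
def binom {S : Type*} [CommRing S] (A Y : S) (k J : ℕ) : S :=
  ∑ j ∈ Finset.range (J + 1), ((k + j - 1).choose j : S) * (A ^ (J - j) * Y ^ j)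

variable {S : Type*} [CommRing S] (A Y : S)

theorem binom_succ_right (k J : ℕ) :
    binom A Y k (J + 1) = A * binom A Y k J + ((k + J).choose (J + 1) : S) * Y ^ (J + 1) := by
  rw [binom, Finset.sum_range_succ, binom, Finset.mul_sum]
  congr 1
  · refine Finset.sum_congr rfl fun j hj => ?_
    have : j ≤ J := by
      rw [Finset.mem_range] at hj
      omega
    rw [Nat.succ_sub this, pow_succ]
    ring
  · simp [← add_assoc]

theorem sub_mul_binom_succ_left (k J : ℕ) :
    (A - Y) * binom A Y (k + 1) J =
      A * binom A Y k J - ((k + J).choose J : S) * Y ^ (J + 1) := by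
  induction J with
  | zero => simp [binom]
  | succ J ih =>
    have h : ((k + 1 + J).choose (J + 1) : S) = (k + J).choose J + (k + J).choose (J + 1) := by
      rw [show k + 1 + J = k + J + 1 by ring, Nat.choose_succ_succ]
      push_cast
      ring
    rw [binom_succ_right, binom_succ_right, mul_add, mul_left_comm, ih, ← add_assoc k J 1,
      show k + J + 1 = k + 1 + J by ring, h]
    ring

/-- This is `(A - Y) ^ (-k) = ∑ choose (k + j - 1) j A ^ (-k - j) Y ^ j` with denominators cleared.
The remainder is a multiple of `Y ^ (J + 1)`, so it is small when `Y` is divisible by `p`. -/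
theorem sub_pow_mul_binom (k J : ℕ) :
    ∃ E, (A - Y) ^ k * binom A Y k J = A ^ (k + J) + Y ^ (J + 1) * E := by
  induction k with
  | zero =>
    refine ⟨0, ?_⟩
    rw [binom, Finset.sum_eq_single 0]
    · simp
    · intro j _ hj
      rw [Nat.choose_eq_zero_of_lt (by omega)]
      simp
    · simp
  | succ k ih =>
    obtain ⟨E, hE⟩ := ih
    refine ⟨A * E - (A - Y) ^ k * (k + J).choose J, ?_⟩
    rw [pow_succ, mul_assoc, sub_mul_binom_succ_left, mul_sub, mul_left_comm, hE]
    ring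

end Binomial

/-! ### Divisibility of `p ^ j / j!` and of factorials -/

section Factorial

/-- Legendre's formula gives `(p - 1) v < j + 1` for the valuation `v` of `(j + 1)!`, so `2 v ≤ j`
when `p > 2`. Thus `p ^ (j + 1) / (j + 1)!` is divisible by `p` and tends to zero. For `p = 2`
convergence fails: the valuation is 1 whenever `j + 1` is a power of 2. -/
theorem exists_mul_factorial_eq_pow {R : Type*} [CommRing R] {p : ℕ} (hp : p.Prime) (hp2 : 2 < p)
    [IsAdicComplete (Ideal.span {(p : R)}) R] (j : ℕ) :
    ∃ c : R, (p : R) * ((p : R) ^ (j / 2) * c) * ((j + 1).factorial : R) = (p : R) ^ (j + 1) := by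
  have := Fact.mk hp
  obtain ⟨v, m, hm, hv⟩ := Nat.exists_eq_pow_mul_and_not_dvd (Nat.factorial_ne_zero (j + 1)) p
    hp.ne_one
  have hv1 : padicValNat p (j + 1).factorial = v := by
    rw [hv, padicValNat.mul (pow_ne_zero _ hp.ne_zero) (by rintro rfl; simp at hm),
      padicValNat.prime_pow, padicValNat.eq_zero_of_not_dvd hm, add_zero]
  have hv2 := sub_one_mul_padicValNat_factorial_lt_of_ne_zero (p := p) (Nat.succ_ne_zero j)
  rw [hv1] at hv2
  have hv3 : 2 * v ≤ j := by
    have : 2 * v ≤ (p - 1) * v := Nat.mul_le_mul_right v (by omega)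
    omega
  obtain ⟨u, hu⟩ := isUnit_natCast_of_coprime (R := R) p
    ((Nat.Prime.coprime_iff_not_dvd hp).mpr hm).symm
  refine ⟨(p : R) ^ (j - j / 2 - v) * ↑u⁻¹, ?_⟩
  rw [hv]
  push_cast
  rw [← hu]
  have h1 : (p : R) ^ (j + 1) = p * (p ^ (j / 2) * p ^ (j - j / 2 - v) * p ^ v) := by
    rw [← pow_add, ← pow_add, ← pow_succ']
    congr 1
    omega
  rw [h1]
  linear_combination (p : R) * p ^ (j / 2) * p ^ (j - j / 2 - v) * p ^ v * u.inv_mul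

/-- For `p > 1`, `(k p)! = k p (k p - 1)!` and `k ≤ k p - 1`. It provides the factor `p` in the
Cartier images of poles of order greater than `p`. -/
theorem prime_mul_factorial_dvd {p : ℕ} {k d : ℕ} (hk : 0 < k) (h : k * p ≤ d) (hp : 0 < p) :
    p * k.factorial ∣ d.factorial := by
  refine dvd_trans ?_ (Nat.factorial_dvd_factorial h)
  obtain ⟨N, hN⟩ : ∃ N, k * p = N + 1 := Nat.exists_eq_succ_of_ne_zero (by positivity)
  obtain ⟨k', rfl⟩ : ∃ k', k = k' + 1 := Nat.exists_eq_succ_of_ne_zero hk.ne'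
  rcases Nat.lt_or_ge 1 p with hp1 | hp1
  · rw [hN, Nat.factorial_succ N, ← hN, mul_comm (_ * p), mul_comm _ p, mul_left_comm]
    refine mul_dvd_mul_left p (Dvd.dvd.mul_right (Nat.factorial_dvd_factorial ?_) _)
    nlinarith
  · obtain rfl : p = 1 := by omega
    simp

end Factorial

/-! ### The Cartier operator on rational functions -/

section Cartier

variable {R : Type*} [CommRing R] {n : ℕ} {p : ℕ} {σ : R →+* R}
  {Δ μ : Set (Fin n → ℝ)} {b : Fin n → ℤ} {l : (Fin n → ℤ) →+ ℝ} {g : Laurent R n}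

theorem inDilate_of_nsmul (hp : 0 < p) {A : Set (Fin n → ℝ)} {m : ℕ} {u : Fin n → ℤ}
    (h : InDilate A (p * m) (p • u)) : InDilate A m u := by
  obtain ⟨w, hw, e⟩ := h
  refine ⟨w, hw, ?_⟩
  have hp' : (p : ℝ) ≠ 0 := Nat.cast_ne_zero.mpr hp.ne'
  rw [toReal_nsmul, Nat.cast_mul, ← smul_smul] at e
  exact smul_right_injective _ hp' e

theorem inDilate_nsmul (A : Set (Fin n → ℝ)) {u : Fin n → ℤ} (h : toReal u ∈ A) (m : ℕ) :
    InDilate A m (m • u) :=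
  ⟨_, h, toReal_nsmul _ _⟩

theorem inDilate_one {A : Set (Fin n → ℝ)} {u : Fin n → ℤ} :
    InDilate A 1 u ↔ toReal u ∈ A :=
  ⟨fun ⟨w, hw, e⟩ => by rwa [e, Nat.cast_one, one_smul], fun h => ⟨_, h, by simp⟩⟩

/-- Both `g ^ p` and `g^σ(x ^ p)` are supported in `p Δ`. A nonzero coefficient of `G` stays nonzero
after multiplication by `p`, so it must come from one of them. -/
theorem IsFrame.exists_frob_sub [IsDomain R] [CharZero R] (h : IsFrame Δ μ b l) (hp : p.Prime)
    (hσ : ∀ r : R, (p : R) ∣ σ r - r ^ p) (hg : Adapted Δ b l g) :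
    ∃ G : Laurent R n, g ^ p = frob p (twist σ g) - (p : Laurent R n) * G ∧
      ∀ a, G.coeff a ≠ 0 → InDilate Δ p a := by
  obtain ⟨G, hG⟩ := natCast_dvd_pow_sub_frob hp hσ g
  refine ⟨-G, by rw [mul_neg, ← hG]; ring, fun a ha => ?_⟩
  have h1 : (p : R) * G.coeff a = (g ^ p).coeff a - (frob p (twist σ g)).coeff a := by
    rw [← Finsupp.sub_apply, ← AddMonoidAlgebra.coeff_sub, hG, AddMonoidAlgebra.natCast_def,
      AddMonoidAlgebra.coeff_single_mul_apply, neg_zero, zero_add]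
  have h2 : (p : R) * G.coeff a ≠ 0 :=
    mul_ne_zero (natCast_ne_zero_of_prime hp) fun h0 => ha (by simp [h0])
  rw [h1] at h2
  by_cases h3 : (g ^ p).coeff a = 0
  · have h4 : (frob p (twist σ g)).coeff a ≠ 0 := fun h0 => h2 (by rw [h3, h0, sub_zero])
    obtain ⟨c, hc, rfl⟩ := exists_of_frob_coeff_ne_zero h4
    exact inDilate_nsmul Δ ((hg.twist σ).support c hc) p
  · have := h.support_pow (m := 1) (fun a ha => inDilate_one.mpr (hg.support a ha)) p h3
    rwa [one_mul] at this

/-- The expansion of the Cartier image of `ω_(d, u)`, up to a remainder divisible by a power of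
`p`. -/
theorem dvd_cartier_omega_sub {gσ : Laurent R n} (hg : Leading l b g) (hgσ : Leading l b gσ)
    (hp : 0 < p) {G : Laurent R n} (hG : g ^ p = frob p gσ - (p : Laurent R n) * G)
    {d k : ℕ} (hk : 0 < k) (hd : d ≤ p * k) (u : Fin n → ℤ) {a : R}
    (ha : a * ((k - 1).factorial : R) = ((d - 1).factorial : R)) {c : ℕ → R}
    (hc : ∀ j, c j * (j.factorial : R) = (p : R) ^ j) (J : ℕ) (x : Fin n → ℤ) :
    (p : R) ^ (J + 1) ∣ cartierHom R n p (omega g b d u) x - a * ∑ j ∈ Finset.range (J + 1), c j *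
      omegaPoly gσ b (k + j) (cartierPoly p hp
        (G ^ j * (AddMonoidAlgebra.single u 1 * g ^ (p * k - d)))) x := by
  set Q : Laurent R n := AddMonoidAlgebra.single u 1 * g ^ (p * k - d) with hQ
  set A : Laurent R n := frob p gσ with hA
  set F := omega g b d u with hF
  set η : ℕ → (Fin n → ℤ) → R :=
    fun j => omegaPoly gσ b (k + j) (cartierPoly p hp (G ^ j * Q)) with hη
  -- Write `ω_(d, u)` as `(d - 1)! x ^ u g ^ (p k - d) / (g ^ p) ^ k`, so that the denominator is a
  -- power of `g ^ p`.
  have h1 : act (g ^ (p * k)) F = ((d - 1).factorial : R) • ⇑Q.coeff := by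
    have : g ^ (p * k) = g ^ (p * k - d) * g ^ d := by rw [← pow_add, Nat.sub_add_cancel hd]
    rw [this, act_mul, act_omega hg, act_coeff, hQ]
    ext y
    have : (AddMonoidAlgebra.single u ((d - 1).factorial : R) : Laurent R n) =
        ((d - 1).factorial : R) • AddMonoidAlgebra.single u 1 := by
      rw [AddMonoidAlgebra.smul_single, smul_eq_mul, mul_one]
    rw [this, mul_comm, smul_mul_assoc, AddMonoidAlgebra.coeff_smul]
    rfl
  obtain ⟨E, hE⟩ := sub_pow_mul_binom A ((p : Laurent R n) * G) k J
  rw [← hG, ← pow_mul] at hE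
  have h2 : cartierHom R n p (act (binom A ((p : Laurent R n) * G) k J) (act (g ^ (p * k)) F)) =
      act (gσ ^ (k + J)) (cartierHom R n p F) +
        (p : R) ^ (J + 1) • cartierHom R n p (act (G ^ (J + 1) * E) F) := by
    have : A ^ (k + J) + ((p : Laurent R n) * G) ^ (J + 1) * E =
        frob p (gσ ^ (k + J)) + (p : R) ^ (J + 1) • (G ^ (J + 1) * E) := by
      rw [map_pow, mul_pow, mul_assoc, ← Nat.cast_pow, ← Nat.cast_pow, Nat.cast_smul_eq_nsmul,
        nsmul_eq_mul]
    rw [← act_mul, mul_comm, hE, this, map_add, LinearMap.add_apply, map_add, cartierHom_act,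
      map_smul, LinearMap.smul_apply, map_smul]
  have h3 : cartierHom R n p (act (binom A ((p : Laurent R n) * G) k J) (act (g ^ (p * k)) F)) =
      act (gσ ^ (k + J)) (a • ∑ j ∈ Finset.range (J + 1), c j • η j) := by
    rw [h1, map_smul, map_smul, binom, map_sum, LinearMap.sum_apply, map_sum, map_smul, map_sum,
      Finset.smul_sum, Finset.smul_sum]
    refine Finset.sum_congr rfl fun j hj => ?_
    have hj : j ≤ J := by
      rw [Finset.mem_range] at hj
      omega
    have e1 : ((k + j - 1).choose j : Laurent R n) * (A ^ (J - j) * ((p : Laurent R n) * G) ^ j) =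
        (((k + j - 1).choose j : R) * (p : R) ^ j) • (frob p (gσ ^ (J - j)) * G ^ j) := by
      rw [map_pow, ← Nat.cast_pow, ← Nat.cast_mul, Nat.cast_smul_eq_nsmul, nsmul_eq_mul]
      push_cast
      ring
    have e2 : gσ ^ (k + J) = gσ ^ (J - j) * gσ ^ (k + j) := by
      rw [← pow_add]
      congr 1
      omega
    -- With `a = (d - 1)! / (k - 1)!` and `c j = p ^ j / j!`, the binomial coefficient is absorbed
    -- in the factorial `(k + j - 1)!` built into functions of pole order `k + j`.
    have e3 : (a * c j) * ((k + j - 1).factorial : R) =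
        ((d - 1).factorial : R) * (((k + j - 1).choose j : R) * (p : R) ^ j) := by
      have e4 : (k + j - 1).choose j * j.factorial * (k - 1).factorial = (k + j - 1).factorial := by
        have := Nat.choose_mul_factorial_mul_factorial (n := k + j - 1) (k := j) (by omega)
        rwa [show k + j - 1 - j = k - 1 by omega] at this
      rw [← e4, ← hc j, ← ha]
      push_cast
      ring
    rw [e1, map_smul, LinearMap.smul_apply, map_smul, smul_smul, ← e3, act_mul, cartierHom_act,
      act_coeff, ← cartierPoly_coeff p hp, map_smul, smul_smul, e2, act_mul, hη, act_omegaPoly hgσ,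
      map_smul, smul_smul]
  have hlow : Low l (cartierHom R n p F - a • ∑ j ∈ Finset.range (J + 1), c j • η j) :=
    (low_cartier hp (low_omega hg d u)).sub
      ((low_sum _ fun j _ => (low_omegaPoly hgσ _ _).smul _).smul _)
  -- After multiplication by `(g^σ) ^ (k + J)` the two sides differ by the binomial remainder, a
  -- multiple of `p ^ (J + 1)`; divisibility descends through the multiplication.
  have := hgσ.dvd_of_dvd_act_pow (q := (p : R) ^ (J + 1)) (k + J) hlow (fun y => by
    rw [map_sub, ← h3, h2, sub_add_cancel_left]
    exact (dvd_neg.mpr (dvd_mul_right _ _))) x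
  simpa [Finset.sum_apply] using this

/-- The term `j = 0` of the expansion is kept; all terms with `j ≥ 1` are divisible by `p`, and
after division by `a p` they converge in the completion of `Ω`. -/
theorem IsFrame.cartier_omega [IsDomain R] [CharZero R] [IsAdicComplete (Ideal.span {(p : R)}) R]
    (h : IsFrame Δ μ b l) (hp : p.Prime) (hp2 : 2 < p)
    (hσ : ∀ r : R, (p : R) ∣ σ r - r ^ p) (hg : Adapted Δ b l g)
    {d k : ℕ} (hd0 : 0 < d) (hk : 0 < k) (hd : d ≤ p * k) {u : Fin n → ℤ} (hu : InDilate μ d u)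
    {a : R} (ha : a * ((k - 1).factorial : R) = ((d - 1).factorial : R)) :
    omegaPoly (twist σ g) b k (cartierPoly p hp.pos
        (AddMonoidAlgebra.single u 1 * g ^ (p * k - d))) ∈ Omega (twist σ g) b μ ∧
      ∃ F' ∈ hat p (twist σ g) b μ, cartierHom R n p (omega g b d u) =
        a • (omegaPoly (twist σ g) b k (cartierPoly p hp.pos
          (AddMonoidAlgebra.single u 1 * g ^ (p * k - d))) + (p : R) • F') := by
  obtain ⟨G, hG, hGs⟩ := h.exists_frob_sub hp hσ hg
  set η : ℕ → (Fin n → ℤ) → R := fun j => omegaPoly (twist σ g) b (k + j)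
    (cartierPoly p hp.pos (G ^ j * (AddMonoidAlgebra.single u 1 * g ^ (p * k - d)))) with hη
  -- The numerator `G ^ j x ^ u g ^ (p k - d)` is supported in `(d + (p k - d) + p j) μ = p (k + j)
  -- μ`, and the Cartier operator divides exponents by `p`.
  have hηΩ : ∀ j, η j ∈ Omega (twist σ g) b μ := by
    refine fun j => omegaPoly_mem (by omega) fun w hw => inDilate_of_nsmul hp.pos ?_
    change (G ^ j * (AddMonoidAlgebra.single u 1 * g ^ (p * k - d))).coeff (p • w) ≠ 0 at hw
    obtain ⟨v, w', e, hv, hw'⟩ := exists_add_of_coeff_mul_ne_zero hw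
    rw [AddMonoidAlgebra.coeff_single_mul_apply, one_mul] at hw'
    have h1 := h.support_pow hGs j hv
    have h2 := h.support_pow (m := 1) (fun a ha => inDilate_one.mpr (hg.support a ha)) _ hw'
    have h3 := h.absorb_dilate (by omega) (h.absorb_dilate hd0 hu h2) h1
    rw [← e]
    convert h3 using 1
    · rw [one_mul, Nat.add_sub_cancel' hd, mul_add]
    · abel
  choose e he using fun j => exists_mul_factorial_eq_pow (R := R) hp hp2 j
  set c' : ℕ → R := fun j => (p : R) ^ (j / 2) * e j with hc'
  have hη0 : η 0 = omegaPoly (twist σ g) b k (cartierPoly p hp.pos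
      (AddMonoidAlgebra.single u 1 * g ^ (p * k - d))) := by
    simp [hη]
  -- The coefficients are only known to be divisible by `p ^ (j / 2)`, so two terms are added at
  -- each `p`-adic level.
  set y : ℕ → (Fin n → ℤ) → R := fun N => ∑ j ∈ Finset.range (2 * N), c' j • η (j + 1) with hy
  have hyz : ∀ N, y (N + 1) = y N +
      (p : R) ^ N • (e (2 * N) • η (2 * N + 1) + e (2 * N + 1) • η (2 * N + 2)) := by
    intro N
    have e1 : 2 * N / 2 = N := by omega
    have e2 : (2 * N + 1) / 2 = N := by omega
    simp only [hy, hc']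
    rw [show 2 * (N + 1) = 2 * N + 1 + 1 by ring, Finset.sum_range_succ, Finset.sum_range_succ,
      e1, e2, smul_add, smul_smul, smul_smul, add_assoc]
  obtain ⟨F', hF'⟩ := exists_limit_pi p (y := y) fun N x => by
    rw [hyz, Pi.add_apply, add_sub_cancel_left]
    exact dvd_mul_right _ _
  rw [← hη0]
  refine ⟨hηΩ 0, F', ⟨y, _, fun N => Submodule.sum_mem _ fun j _ => Submodule.smul_mem _ _ (hηΩ _),
    fun N => add_mem (Submodule.smul_mem _ _ (hηΩ _)) (Submodule.smul_mem _ _ (hηΩ _)), hF', hyz⟩,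
    ?_⟩
  ext x
  rw [← sub_eq_zero]
  refine eq_zero_of_forall_pow_dvd p fun N => ?_
  set c : ℕ → R := fun j => Nat.casesOn j 1 fun i => (p : R) * c' i with hc
  have h1 := dvd_cartier_omega_sub hg.leading (hg.twist σ).leading hp.pos hG hk hd u ha (c := c)
    (fun j => by cases j with
      | zero => simp [hc]
      | succ j => exact he j) (2 * N) x
  rw [Finset.sum_range_succ'] at h1
  have h2 : ∑ j ∈ Finset.range (2 * N), c (j + 1) * η (j + 1) x = (p : R) * y N x := by
    simp only [hy, Finset.sum_apply, Finset.mul_sum, Pi.smul_apply, smul_eq_mul, hc, mul_assoc]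
  have h3 : cartierHom R n p (omega g b d u) x - (a • (η 0 + (p : R) • F')) x =
      (cartierHom R n p (omega g b d u) x - a * (∑ j ∈ Finset.range (2 * N),
        c (j + 1) * η (j + 1) x + c 0 * η 0 x)) - a * p * (F' x - y N x) := by
    rw [h2, show c 0 = 1 from rfl]
    simp only [Pi.smul_apply, Pi.add_apply, smul_eq_mul]
    ring
  rw [h3]
  exact dvd_sub ((pow_dvd_pow _ (by omega)).trans h1) ((hF' N x).mul_left _)

/-- The matrix whose entry at `(u, v)` is the coefficient of `x ^ (m v - u)` in `g ^ (m - 1)`. -/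
def hasseWitt (g : Laurent R n) (L : Finset (Fin n → ℤ)) (m : ℕ) : Matrix L L R :=
  Matrix.of fun u v => (g ^ (m - 1)).coeff (m • (v : Fin n → ℤ) - (u : Fin n → ℤ))

/-- The index set `L` does not depend on the polynomial, so the matrices of `g` and of its twist
have the same type and can be multiplied. -/
theorem hasseWitt_twist (σ : R →+* R) (g : Laurent R n) (L : Finset (Fin n → ℤ)) (m : ℕ) :
    hasseWitt (twist σ g) L m = (hasseWitt g L m).map σ := by
  ext u v
  simp only [hasseWitt, Matrix.of_apply, Matrix.map_apply]
  rw [← twist_pow, twist_coeff]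

/-- Linear combinations of the functions `x ^ u / g` with `u ∈ L`. -/
def comb (g : Laurent R n) (b : Fin n → ℤ) (L : Finset (Fin n → ℤ)) :
    (L → R) →ₗ[R] ((Fin n → ℤ) → R) :=
  Fintype.linearCombination R fun u : L => omega g b 1 (u : Fin n → ℤ)

theorem comb_apply (g : Laurent R n) (b : Fin n → ℤ) (L : Finset (Fin n → ℤ)) (v : L → R) :
    comb g b L v = ∑ u, v u • omega g b 1 (u : Fin n → ℤ) :=
  Fintype.linearCombination_apply _ _ _

theorem comb_mem_Omega {L : Finset (Fin n → ℤ)} (hL : ∀ u ∈ L, toReal u ∈ μ) (v : L → R) :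
    comb g b L v ∈ Omega g b μ := by
  rw [comb_apply]
  exact Submodule.sum_mem _ fun u _ => Submodule.smul_mem _ _ <|
    Submodule.subset_span ⟨1, u, one_pos, ⟨_, hL _ u.2, by simp⟩, rfl⟩

theorem omegaPoly_one_eq_comb {L : Finset (Fin n → ℤ)} {P : Laurent R n}
    (hP : ∀ u, P.coeff u ≠ 0 → u ∈ L) :
    omegaPoly g b 1 P = comb g b L fun u => P.coeff u := by
  rw [comb_apply, omegaPoly, Finset.sum_coe_sort L fun u => P.coeff u • omega g b 1 u]
  refine Finset.sum_subset (fun u hu => hP u (Finsupp.mem_support_iff.mp hu)) fun u _ hu => ?_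
  rw [Finsupp.notMem_support_iff.mp hu, zero_smul]

/-- The functional sending `F` to the coefficient of `x ^ (m v)` in `g ^ m F`. -/
def period (g : Laurent R n) (m : ℕ) (v : Fin n → ℤ) : ((Fin n → ℤ) → R) →ₗ[R] R :=
  LinearMap.proj (m • v) ∘ₗ act (g ^ m)

theorem period_apply (g : Laurent R n) (m : ℕ) (v : Fin n → ℤ) (F : (Fin n → ℤ) → R) :
    period g m v F = act (g ^ m) F (m • v) := rfl

/-- Indeed `g ^ m · x ^ u / g = x ^ u g ^ (m - 1)`. -/
theorem period_omega (hg : Leading l b g) {m : ℕ} (hm : 0 < m) (u v : Fin n → ℤ) :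
    period g m v (omega g b 1 u) = (g ^ (m - 1)).coeff (m • v - u) := by
  have h1 := act_omega hg 1 u
  rw [pow_one, Nat.sub_self, Nat.factorial_zero, Nat.cast_one] at h1
  rw [period_apply, show g ^ m = g ^ (m - 1) * g by rw [← pow_succ, Nat.sub_add_cancel hm],
    act_mul, h1, act_coeff, mul_comm, AddMonoidAlgebra.coeff_single_mul_apply, one_mul,
    neg_add_eq_sub]

theorem period_comb (hg : Leading l b g) {m : ℕ} (hm : 0 < m) {L : Finset (Fin n → ℤ)}
    (a : L → R) (v : L) :
    period g m v (comb g b L a) = Matrix.vecMul a (hasseWitt g L m) v := by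
  rw [comb_apply, map_sum, Matrix.vecMul, dotProduct]
  refine Finset.sum_congr rfl fun u _ => ?_
  rw [map_smul, period_omega hg hm]
  rfl

variable [IsDomain R] [CharZero R] [IsAdicComplete (Ideal.span {(p : R)}) R]

/-- Take `d = k = 1`: the leading term is the Cartier image of `x ^ u g ^ (p - 1)` over `g^σ`, whose
coefficients form row `u` of the Hasse–Witt matrix. -/
theorem IsFrame.cartier_comb (h : IsFrame Δ μ b l) (hp : p.Prime) (hp2 : 2 < p)
    (hσ : ∀ r : R, (p : R) ∣ σ r - r ^ p) (hg : Adapted Δ b l g) {L : Finset (Fin n → ℤ)}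
    (hL : ∀ u, u ∈ L ↔ toReal u ∈ μ) (v : L → R) :
    ∃ F' ∈ hat p (twist σ g) b μ, cartierHom R n p (comb g b L v) =
      comb (twist σ g) b L (Matrix.vecMul v (hasseWitt g L p)) + (p : R) • F' := by
  have h1 : ∀ u : L, ∃ F' ∈ hat p (twist σ g) b μ, cartierHom R n p (omega g b 1 u) =
      comb (twist σ g) b L (hasseWitt g L p u) + (p : R) • F' := by
    intro u
    have hu : InDilate μ 1 (u : Fin n → ℤ) := inDilate_one.mpr ((hL _).mp u.2)
    obtain ⟨-, F', hF', e⟩ := h.cartier_omega hp hp2 hσ hg (d := 1) (k := 1) one_pos one_pos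
      (by have := hp.pos; omega) hu (a := 1) (by simp)
    refine ⟨F', hF', ?_⟩
    rw [e, one_smul, omegaPoly_one_eq_comb (L := L)]
    · congr 2
      funext v
      change (AddMonoidAlgebra.single (u : Fin n → ℤ) 1 * g ^ (p * 1 - 1)).coeff
        (p • (v : Fin n → ℤ)) = _
      rw [AddMonoidAlgebra.coeff_single_mul_apply, one_mul, mul_one, neg_add_eq_sub]
      rfl
    · intro w hw
      change (AddMonoidAlgebra.single (u : Fin n → ℤ) 1 * g ^ (p * 1 - 1)).coeff (p • w) ≠ 0 at hw
      rw [AddMonoidAlgebra.coeff_single_mul_apply, one_mul] at hw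
      have h2 := h.support_pow (m := 1) (fun a ha => inDilate_one.mpr (hg.support a ha)) _ hw
      have h3 := h.absorb_dilate one_pos hu h2
      rw [add_neg_cancel_left, one_mul, mul_one, Nat.add_sub_cancel' hp.one_lt.le] at h3
      rw [hL, ← inDilate_one]
      exact inDilate_of_nsmul hp.pos (by rwa [mul_one])
  choose E hE he using h1
  refine ⟨∑ u, v u • E u, Submodule.sum_mem _ fun u _ => Submodule.smul_mem _ _ (hE u), ?_⟩
  rw [comb_apply, map_sum, Matrix.vecMul_eq_sum, map_sum, Finset.smul_sum,
    ← Finset.sum_add_distrib]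
  refine Finset.sum_congr rfl fun u _ => ?_
  rw [map_smul, he, smul_add, map_smul, smul_comm]

theorem IsFrame.cartier_Omega (h : IsFrame Δ μ b l) (hp : p.Prime) (hp2 : 2 < p)
    (hσ : ∀ r : R, (p : R) ∣ σ r - r ^ p) (hg : Adapted Δ b l g) {L : Finset (Fin n → ℤ)}
    (hL : ∀ u, u ∈ L ↔ toReal u ∈ μ) {F : (Fin n → ℤ) → R} (hF : F ∈ Omega g b μ) :
    ∃ v : L → R, ∃ F' ∈ hat p (twist σ g) b μ, cartierHom R n p F =
      comb (twist σ g) b L v + (p : R) • F' := by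
  induction hF using Submodule.span_induction with
  | zero => exact ⟨0, 0, zero_mem _, by simp⟩
  | add F₁ F₂ _ _ h₁ h₂ =>
    obtain ⟨v₁, E₁, hE₁, e₁⟩ := h₁
    obtain ⟨v₂, E₂, hE₂, e₂⟩ := h₂
    refine ⟨v₁ + v₂, E₁ + E₂, add_mem hE₁ hE₂, ?_⟩
    rw [map_add, e₁, e₂, map_add, smul_add]
    abel
  | smul c F _ h₁ =>
    obtain ⟨v₁, E₁, hE₁, e₁⟩ := h₁
    refine ⟨c • v₁, c • E₁, Submodule.smul_mem _ _ hE₁, ?_⟩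
    rw [map_smul, e₁, map_smul, smul_add, smul_comm]
  | mem F hF =>
    obtain ⟨d, u, hd, hu, rfl⟩ := hF
    rcases Nat.lt_or_ge p d with hpd | hpd
    · have hk : 0 < (d - 1) / p := Nat.div_pos (by omega) hp.pos
      have hkd : (d - 1) / p * p ≤ d - 1 := Nat.div_mul_le_self _ _
      have hdk : d ≤ p * ((d - 1) / p + 1) := by
        have := Nat.lt_mul_div_succ (d - 1) hp.pos
        omega
      obtain ⟨a, ha⟩ := prime_mul_factorial_dvd hk hkd hp.pos
      obtain ⟨hΩ, F', hF', e⟩ := h.cartier_omega hp hp2 hσ hg hd (Nat.succ_pos _) hdk hu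
        (a := (p : R) * a) (by rw [ha, Nat.succ_sub_one]; push_cast; ring)
      refine ⟨0, _, Submodule.smul_mem _ (a : R) (add_mem (Omega_le_hat hΩ)
        (Submodule.smul_mem _ (p : R) hF')), ?_⟩
      rw [e, map_zero, zero_add, smul_smul]
    · obtain ⟨-, F', hF', e⟩ := h.cartier_omega hp hp2 hσ hg hd one_pos (by omega) hu
        (a := ((d - 1).factorial : R)) (by simp)
      have hs : ∀ w, (cartierPoly p hp.pos
          (AddMonoidAlgebra.single u 1 * g ^ (p * 1 - d))).coeff w ≠ 0 → w ∈ L := by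
        intro w hw
        change (AddMonoidAlgebra.single u 1 * g ^ (p * 1 - d)).coeff (p • w) ≠ 0 at hw
        rw [AddMonoidAlgebra.coeff_single_mul_apply, one_mul] at hw
        have h2 := h.support_pow (m := 1) (fun a ha => inDilate_one.mpr (hg.support a ha)) _ hw
        have h3 := h.absorb_dilate hd hu h2
        rw [add_neg_cancel_left, one_mul, mul_one, Nat.add_sub_cancel' hpd] at h3
        rw [hL, ← inDilate_one]
        exact inDilate_of_nsmul hp.pos (by rwa [mul_one])
      refine ⟨((d - 1).factorial : R) • fun w : L => (cartierPoly p hp.pos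
        (AddMonoidAlgebra.single u 1 * g ^ (p * 1 - d))).coeff w, _,
        Submodule.smul_mem _ ((d - 1).factorial : R) hF', ?_⟩
      rw [e, smul_add, smul_comm, omegaPoly_one_eq_comb hs, map_smul]

theorem IsFrame.cartier_hat (h : IsFrame Δ μ b l) (hp : p.Prime) (hp2 : 2 < p)
    (hσ : ∀ r : R, (p : R) ∣ σ r - r ^ p) (hg : Adapted Δ b l g) {L : Finset (Fin n → ℤ)}
    (hL : ∀ u, u ∈ L ↔ toReal u ∈ μ) {F : (Fin n → ℤ) → R} (hF : F ∈ hat p g b μ) :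
    ∃ v : L → R, ∃ F' ∈ hat p (twist σ g) b μ, cartierHom R n p F =
      comb (twist σ g) b L v + (p : R) • F' := by
  obtain ⟨w, hw, E, hE, rfl⟩ := exists_add_smul_of_mem_hat hp hF
  obtain ⟨v, F', hF', e⟩ := h.cartier_Omega hp hp2 hσ hg hL hw
  have h1 : cartierHom R n p E ∈ hat p (twist σ g) b μ := by
    refine map_mem_hat (cartierHom R n p).toAddMonoidHom (fun w hw => ?_) hE
    obtain ⟨v, F', hF', e⟩ := h.cartier_Omega hp hp2 hσ hg hL hw
    rw [LinearMap.toAddMonoidHom_coe, e]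
    exact add_mem (Omega_le_hat (comb_mem_Omega (fun u hu => (hL u).mp hu) v))
      (Submodule.smul_mem _ _ hF')
  refine ⟨v, F' + cartierHom R n p E, add_mem hF' h1, ?_⟩
  rw [map_add, e, map_smul, smul_add, add_assoc]

theorem IsFrame.cartier_mem_hat (h : IsFrame Δ μ b l) (hp : p.Prime) (hp2 : 2 < p)
    (hσ : ∀ r : R, (p : R) ∣ σ r - r ^ p) (hg : Adapted Δ b l g) {L : Finset (Fin n → ℤ)}
    (hL : ∀ u, u ∈ L ↔ toReal u ∈ μ) {F : (Fin n → ℤ) → R} (hF : F ∈ hat p g b μ) :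
    cartierHom R n p F ∈ hat p (twist σ g) b μ := by
  obtain ⟨v, F', hF', e⟩ := h.cartier_hat hp hp2 hσ hg hL hF
  rw [e]
  exact add_mem (Omega_le_hat (comb_mem_Omega (fun u hu => (hL u).mp hu) v))
    (Submodule.smul_mem _ _ hF')

end Cartier

/-! ### Formal derivatives through the Cartier operator -/

section Exact

variable {R : Type*} [CommRing R] {n : ℕ} {p : ℕ} {Δ : Set (Fin n → ℝ)} {b : Fin n → ℤ}

theorem cartierHom_pow_apply (s : ℕ) (F : (Fin n → ℤ) → R) (k : Fin n → ℤ) :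
    (cartierHom R n p ^ s) F k = F (p ^ s • k) := by
  induction s generalizing F with
  | zero => simp
  | succ s ih =>
    rw [pow_succ, Module.End.mul_apply, ih, cartierHom_apply, smul_smul, ← pow_succ']

theorem isUnit_intCast_of_not_dvd (hp : p.Prime) [IsAdicComplete (Ideal.span {(p : R)}) R] {z : ℤ}
    (hz : ¬ (p : ℤ) ∣ z) : IsUnit (z : R) := by
  have h1 : IsUnit ((z.natAbs : ℕ) : R) := by
    refine isUnit_natCast_of_coprime p (Nat.Coprime.symm ((Nat.Prime.coprime_iff_not_dvd hp).mpr ?_))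
    rwa [← Int.natCast_dvd]
  rcases Int.natAbs_eq z with h | h
  · rw [h, Int.cast_natCast]
    exact h1
  · rw [h, Int.cast_neg, Int.cast_natCast]
    exact h1.neg

/-- Take the least `p`-adic valuation among the coordinates, at a coordinate attaining it. -/
theorem exists_nsmul_not_dvd (hp : p.Prime) {k : Fin n → ℤ} (hk : k ≠ 0) :
    ∃ (s : ℕ) (k' : Fin n → ℤ) (i : Fin n), k = p ^ s • k' ∧ ¬ (p : ℤ) ∣ k' i := by
  obtain ⟨j, hj⟩ : ∃ j, k j ≠ 0 := by
    by_contra! h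
    exact hk (funext h)
  obtain ⟨i, -, hi⟩ := Finset.exists_min_image Finset.univ (fun i => emultiplicity (p : ℤ) (k i))
    ⟨j, Finset.mem_univ j⟩
  have hfin : FiniteMultiplicity (p : ℤ) (k i) := by
    refine finiteMultiplicity_iff_emultiplicity_ne_top.mpr (ne_top_of_le_ne_top ?_
      (hi j (Finset.mem_univ j)))
    exact finiteMultiplicity_iff_emultiplicity_ne_top.mp
      (Int.finiteMultiplicity_iff.mpr ⟨by simpa using hp.ne_one, hj⟩)
  have hdvd : ∀ m, (p : ℤ) ^ multiplicity (p : ℤ) (k i) ∣ k m := fun m =>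
    pow_dvd_of_le_emultiplicity (by
      rw [← hfin.emultiplicity_eq_multiplicity]
      exact hi m (Finset.mem_univ m))
  choose k' hk' using hdvd
  refine ⟨multiplicity (p : ℤ) (k i), k', i, ?_, ?_⟩
  · ext m
    rw [Pi.smul_apply, nsmul_eq_mul, Nat.cast_pow]
    exact hk' m
  · rintro ⟨c, hc⟩
    refine hfin.not_pow_dvd_of_multiplicity_lt (Nat.lt_succ_self _) ⟨c, ?_⟩
    rw [pow_succ, mul_assoc, ← hc]
    exact hk' i

theorem theta_mem_formal (i : Fin n) {F : (Fin n → ℤ) → R} (hF : F ∈ formal R Δ b) :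
    theta i F ∈ formal R Δ b :=
  fun k hk => hF k (right_ne_zero_of_mul hk)

theorem dFormal_le_formal : dFormal R Δ b ≤ formal R Δ b := by
  refine Submodule.span_le.mpr ?_
  rintro G ⟨i, F, hF, rfl⟩
  exact theta_mem_formal i hF

theorem pow_dvd_cartier_of_mem_dFormal {F : (Fin n → ℤ) → R} (hF : F ∈ dFormal R Δ b) (s : ℕ)
    (k : Fin n → ℤ) : (p : R) ^ s ∣ (cartierHom R n p ^ s) F k := by
  rw [cartierHom_pow_apply]
  induction hF using Submodule.span_induction with
  | zero => simp
  | add F G _ _ hF hG => exact dvd_add hF hG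
  | smul c F _ hF => exact hF.mul_left c
  | mem G hG =>
    obtain ⟨i, F, -, rfl⟩ := hG
    simp only [theta, Pi.smul_apply, nsmul_eq_mul]
    push_cast
    exact Dvd.intro _ (mul_assoc _ _ _).symm

/-- Formal derivatives are characterized by the divisibility of their Cartier images. -/
theorem mem_dFormal_iff [IsDomain R] [CharZero R] [IsAdicComplete (Ideal.span {(p : R)}) R]
    (hp : p.Prime) {F : (Fin n → ℤ) → R} :
    F ∈ dFormal R Δ b ↔
      F ∈ formal R Δ b ∧ ∀ (s : ℕ) (k : Fin n → ℤ), (p : R) ^ s ∣ (cartierHom R n p ^ s) F k := by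
  refine ⟨fun hF => ⟨dFormal_le_formal hF, pow_dvd_cartier_of_mem_dFormal hF⟩, ?_⟩
  rintro ⟨hF, hC⟩
  -- The clause `F k = 0 → c = 0` keeps the primitives supported in the cone.
  have key : ∀ k : Fin n → ℤ, ∃ c : Fin n → R, F k = ∑ i, (k i : R) * c i ∧ (F k = 0 → c = 0) := by
    intro k
    by_cases hk : k = 0
    · refine ⟨0, ?_, fun _ => rfl⟩
      subst hk
      simp only [Pi.zero_apply, mul_zero, Finset.sum_const_zero]
      refine eq_zero_of_forall_pow_dvd p fun N => ?_
      have := hC N 0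
      rwa [cartierHom_pow_apply, smul_zero] at this
    -- Here `F k = p ^ s e` and `k i = p ^ s k' i` with `k' i` a unit, so `F k` is a multiple of `k
    -- i` and a primitive in the direction `i` exists.
    · obtain ⟨s, k', i, rfl, hi⟩ := exists_nsmul_not_dvd hp hk
      obtain ⟨e, he⟩ := hC s k'
      rw [cartierHom_pow_apply] at he
      obtain ⟨u, hu⟩ := isUnit_intCast_of_not_dvd (R := R) hp hi
      refine ⟨Pi.single i (↑u⁻¹ * e), ?_, fun h0 => ?_⟩
      · rw [Finset.sum_eq_single i]
        · rw [he, Pi.single_eq_same, Pi.smul_apply, nsmul_eq_mul]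
          push_cast
          rw [← hu, mul_assoc, Units.mul_inv_cancel_left]
        · intro j _ hj
          rw [Pi.single_eq_of_ne hj, mul_zero]
        · simp
      · have : e = 0 := by
          rw [h0] at he
          exact (mul_eq_zero.mp he.symm).resolve_left
            (pow_ne_zero _ (natCast_ne_zero_of_prime hp))
        rw [this, mul_zero, Pi.single_zero]
  choose c hc hc0 using key
  have hsum : F = ∑ i, theta i fun k => c k i := by
    ext k
    rw [Finset.sum_apply]
    exact hc k
  rw [hsum]
  refine Submodule.sum_mem _ fun i _ => Submodule.subset_span ⟨i, _, fun k hk => hF k ?_, rfl⟩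
  exact fun h0 => hk (by rw [hc0 k h0]; rfl)

theorem cartier_mem_formal {F : (Fin n → ℤ) → R} (hp : 0 < p) (hF : F ∈ formal R Δ b) :
    cartierHom R n p F ∈ formal R Δ b := by
  intro k hk
  obtain ⟨w, hw, t, ht, e⟩ := hF _ hk
  have hp' : (p : ℝ) ≠ 0 := Nat.cast_ne_zero.mpr hp.ne'
  refine ⟨w, hw, t / p, by positivity, smul_right_injective _ hp' ?_⟩
  dsimp only
  rw [← toReal_nsmul, e, smul_smul, mul_div_cancel₀ _ hp']

theorem cartier_mem_dFormal [IsDomain R] [CharZero R] [IsAdicComplete (Ideal.span {(p : R)}) R]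
    (hp : p.Prime) {F : (Fin n → ℤ) → R} (hF : F ∈ dFormal R Δ b) :
    cartierHom R n p F ∈ dFormal R Δ b := by
  refine (mem_dFormal_iff hp).mpr ⟨cartier_mem_formal hp.pos (dFormal_le_formal hF), fun s k => ?_⟩
  rw [← Module.End.mul_apply, ← pow_succ]
  exact (pow_dvd_pow _ (Nat.le_succ s)).trans (pow_dvd_cartier_of_mem_dFormal hF (s + 1) k)

end Exact

/-! ### Splitting off the formal derivatives -/

section Decomposition

variable {R : Type*} [CommRing R] {n : ℕ} {p : ℕ} {σ : R →+* R}
  {Δ μ : Set (Fin n → ℝ)} {b : Fin n → ℤ} {l : (Fin n → ℤ) →+ ℝ} {L : Finset (Fin n → ℤ)}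
  {g : Laurent R n}

theorem isUnit_hasseWitt_twist (σ : R →+* R) {m : ℕ} (h : IsUnit (hasseWitt g L m)) :
    IsUnit (hasseWitt (twist σ g) L m) := by
  classical
  rw [hasseWitt_twist]
  exact h.map σ.mapMatrix

theorem exists_vecMul_eq {ι : Type*} [Fintype ι] [DecidableEq ι] {A : Matrix ι ι R}
    (hA : IsUnit A) (v : ι → R) : ∃ a, Matrix.vecMul a A = v := by
  refine ⟨Matrix.vecMul v A⁻¹, ?_⟩
  rw [Matrix.vecMul_vecMul, Matrix.nonsing_inv_mul _ ((Matrix.isUnit_iff_isUnit_det A).mp hA),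
    Matrix.vecMul_one]

theorem dvd_of_dvd_vecMul {ι : Type*} [Fintype ι] [DecidableEq ι] {A : Matrix ι ι R}
    (hA : IsUnit A) {q : R} {a : ι → R} (h : ∀ i, q ∣ Matrix.vecMul a A i) (i : ι) : q ∣ a i := by
  have h1 : a = Matrix.vecMul (Matrix.vecMul a A) A⁻¹ := by
    rw [Matrix.vecMul_vecMul, Matrix.mul_nonsing_inv _ ((Matrix.isUnit_iff_isUnit_det A).mp hA),
      Matrix.vecMul_one]
  rw [h1, Matrix.vecMul, dotProduct]
  exact Finset.dvd_sum fun j _ => (h j).mul_right _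

theorem hasseWitt_one : hasseWitt g L 1 = 1 := by
  ext u v
  rw [hasseWitt, Matrix.of_apply, Nat.sub_self, pow_zero, one_smul, AddMonoidAlgebra.one_def,
    AddMonoidAlgebra.coeff_single, Matrix.one_apply, Finsupp.single_apply]
  simp only [eq_comm (a := (0 : Fin n → ℤ)), sub_eq_zero, Subtype.coe_inj, eq_comm (a := v)]

/-- The period with `m = 1` reads off the coefficients, since `β_1` is the identity. -/
theorem dvd_of_dvd_comb (hg : Leading l b g) {q : R} {a : L → R} (h : ∀ k, q ∣ comb g b L a k)
    (u : L) : q ∣ a u := by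
  have h1 := period_comb hg one_pos a u
  rw [hasseWitt_one, Matrix.vecMul_one] at h1
  rw [← h1, period_apply]
  exact dvd_act _ h _

variable [IsDomain R] [CharZero R] [IsAdicComplete (Ideal.span {(p : R)}) R]

/-- Invertibility of Hasse–Witt allows `C F` to be matched modulo `p` by `C` of a combination; the
remainder is `p` times an element over the twist, which is treated by induction. Hence the statement
ranges over all `g`. -/
theorem IsFrame.exists_cartier_sub_comb (h : IsFrame Δ μ b l) (hp : p.Prime) (hp2 : 2 < p)
    (hσ : ∀ r : R, (p : R) ∣ σ r - r ^ p) (hL : ∀ u, u ∈ L ↔ toReal u ∈ μ) (s : ℕ) :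
    ∀ {g : Laurent R n}, Adapted Δ b l g → IsUnit (hasseWitt g L p) →
      ∀ {F : (Fin n → ℤ) → R}, F ∈ hat p g b μ →
      ∃ (a : L → R) (E : (Fin n → ℤ) → R),
        (cartierHom R n p ^ s) (F - comb g b L a) = (p : R) ^ s • E := by
  induction s with
  | zero => exact fun _ _ F _ => ⟨0, F, by simp⟩
  | succ s ih =>
    intro g hg hW F hF
    have hgσ := hg.twist σ
    have hWσ := isUnit_hasseWitt_twist σ hW
    -- Successive approximation of `ξ` by `C` of combinations, seen through `C ^ s`: each round
    -- replaces `η` by a combination (induction hypothesis), then that by `C` of a combination,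
    -- leaving a factor `p` more. After `s` rounds the error is divisible by `p ^ s`.
    have claim : ∀ j : ℕ, ∀ {ξ : (Fin n → ℤ) → R}, ξ ∈ hat p (twist σ g) b μ →
        ∃ a : L → R, ∃ η ∈ hat p (twist σ g) b μ, ∃ E : (Fin n → ℤ) → R,
          (cartierHom R n p ^ s) (ξ - cartierHom R n p (comb g b L a)) =
            (p : R) ^ j • (cartierHom R n p ^ s) η + (p : R) ^ s • E := by
      intro j ξ hξ
      induction j with
      | zero => exact ⟨0, ξ, hξ, 0, by simp⟩
      | succ j ihj =>
        obtain ⟨a, η, hη, E, e⟩ := ihj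
        obtain ⟨v, E', e'⟩ := ih hgσ hWσ hη
        obtain ⟨v₀, hv₀⟩ := exists_vecMul_eq hW v
        obtain ⟨η', hη', e''⟩ := h.cartier_comb hp hp2 hσ hg hL v₀
        rw [hv₀] at e''
        refine ⟨a + (p : R) ^ j • v₀, -η', neg_mem hη', E + (p : R) ^ j • E', ?_⟩
        rw [map_sub, sub_eq_iff_eq_add] at e'
        rw [map_add, map_add, map_smul, map_smul, e'', ← sub_sub, map_sub, e, e', map_smul, map_add,
          map_smul, map_neg, pow_succ]
        module
    obtain ⟨v, ξ, hξ, e⟩ := h.cartier_hat hp hp2 hσ hg hL hF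
    obtain ⟨a, ha⟩ := exists_vecMul_eq hW v
    obtain ⟨ξ', hξ', e'⟩ := h.cartier_comb hp hp2 hσ hg hL a
    rw [ha] at e'
    obtain ⟨a', η, -, E, e''⟩ := claim s (sub_mem hξ hξ')
    refine ⟨a + (p : R) • a', (cartierHom R n p ^ s) η + E, ?_⟩
    have h1 : cartierHom R n p (F - comb g b L (a + (p : R) • a')) =
        (p : R) • (ξ - ξ' - cartierHom R n p (comb g b L a')) := by
      rw [map_add, map_smul, map_sub, map_add, e, e', map_smul]
      module
    rw [pow_succ, Module.End.mul_apply, h1, map_smul, e'']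
    module

/-- Modulo `p`, `C` acts on combinations by Hasse–Witt matrices of successive twists, all
invertible. -/
theorem IsFrame.prime_dvd_of_dvd_cartier_comb (h : IsFrame Δ μ b l) (hp : p.Prime) (hp2 : 2 < p)
    (hσ : ∀ r : R, (p : R) ∣ σ r - r ^ p) (hL : ∀ u, u ∈ L ↔ toReal u ∈ μ) (s : ℕ) :
    ∀ {g : Laurent R n}, Adapted Δ b l g → IsUnit (hasseWitt g L p) → ∀ {a : L → R},
      (∀ k, (p : R) ∣ (cartierHom R n p ^ s) (comb g b L a) k) → ∀ u, (p : R) ∣ a u := by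
  induction s with
  | zero => exact fun hg _ a ha => dvd_of_dvd_comb hg.leading ha
  | succ s ih =>
    intro g hg hW a ha
    obtain ⟨ξ, -, e⟩ := h.cartier_comb hp hp2 hσ hg hL a
    refine dvd_of_dvd_vecMul hW (ih (hg.twist σ) (isUnit_hasseWitt_twist σ hW) fun k => ?_)
    have h1 := ha k
    rw [pow_succ, Module.End.mul_apply, e, map_add, map_smul, Pi.add_apply] at h1
    exact (dvd_add_left (dvd_mul_right _ _)).mp h1

theorem IsFrame.pow_dvd_of_dvd_cartier_comb (h : IsFrame Δ μ b l) (hp : p.Prime) (hp2 : 2 < p)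
    (hσ : ∀ r : R, (p : R) ∣ σ r - r ^ p) (hL : ∀ u, u ∈ L ↔ toReal u ∈ μ)
    (hg : Adapted Δ b l g) (hW : IsUnit (hasseWitt g L p)) (s j : ℕ) :
    ∀ {a : L → R}, (∀ k, (p : R) ^ j ∣ (cartierHom R n p ^ s) (comb g b L a) k) →
      ∀ u, (p : R) ^ j ∣ a u := by
  induction j with
  | zero => simp
  | succ j ih =>
    intro a ha
    have h1 := h.prime_dvd_of_dvd_cartier_comb hp hp2 hσ hL s hg hW fun k =>
      (dvd_pow_self _ (Nat.succ_ne_zero j)).trans (ha k)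
    choose a' ha' using h1
    obtain rfl : a = (p : R) • a' := funext ha'
    have h2 := ih (a := a') fun k => by
      have := ha k
      rw [map_smul, map_smul, pow_succ', Pi.smul_apply, smul_eq_mul] at this
      exact (mul_dvd_mul_iff_left (natCast_ne_zero_of_prime hp)).mp this
    intro u
    rw [pow_succ', Pi.smul_apply, smul_eq_mul]
    exact mul_dvd_mul_left _ (h2 u)

theorem IsFrame.eq_zero_of_comb_mem_dFormal (h : IsFrame Δ μ b l) (hp : p.Prime) (hp2 : 2 < p)
    (hσ : ∀ r : R, (p : R) ∣ σ r - r ^ p) (hL : ∀ u, u ∈ L ↔ toReal u ∈ μ)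
    (hg : Adapted Δ b l g) (hW : IsUnit (hasseWitt g L p)) {a : L → R}
    (ha : comb g b L a ∈ dFormal R Δ b) : a = 0 := by
  ext u
  refine eq_zero_of_forall_pow_dvd p fun N => ?_
  exact h.pow_dvd_of_dvd_cartier_comb hp hp2 hσ hL hg hW N N
    (pow_dvd_cartier_of_mem_dFormal ha N) u

theorem IsFrame.exists_sub_comb_mem_dFormal (h : IsFrame Δ μ b l) (hp : p.Prime) (hp2 : 2 < p)
    (hσ : ∀ r : R, (p : R) ∣ σ r - r ^ p) (hL : ∀ u, u ∈ L ↔ toReal u ∈ μ)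
    (hg : Adapted Δ b l g) (hW : IsUnit (hasseWitt g L p)) {F : (Fin n → ℤ) → R}
    (hF : F ∈ hat p g b μ) : ∃ a : L → R, F - comb g b L a ∈ dFormal R Δ b := by
  choose y E hE using fun s => h.exists_cartier_sub_comb hp hp2 hσ hL s hg hW hF
  -- Both errors, pushed to `C ^ (s + 1)`, are divisible by `p ^ s`, and `C ^ (s + 1)` detects
  -- divisibility of combinations. So the approximate coefficients converge.
  have hy : ∀ s u, (p : R) ^ s ∣ y (s + 1) u - y s u := by
    intro s
    refine h.pow_dvd_of_dvd_cartier_comb hp hp2 hσ hL hg hW (s + 1) s (a := y (s + 1) - y s)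
      fun k => ?_
    have h1 : comb g b L (y (s + 1) - y s) =
        (F - comb g b L (y s)) - (F - comb g b L (y (s + 1))) := by
      rw [map_sub]
      abel
    rw [h1, map_sub, hE (s + 1), pow_succ', Module.End.mul_apply, hE s, map_smul, pow_succ]
    exact dvd_sub (dvd_mul_right _ _) (Dvd.intro _ (mul_assoc _ _ _).symm)
  obtain ⟨a, ha⟩ := exists_limit_pi p hy
  refine ⟨a, (mem_dFormal_iff hp).mpr ⟨sub_mem (hat_le_formal (h.Omega_le_formal hg) hF)
    (h.Omega_le_formal hg (comb_mem_Omega (fun u hu => (hL u).mp hu) a)), fun s k => ?_⟩⟩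
  choose a' ha' using ha s
  have h1 : a - y s = (p : R) ^ s • a' := funext ha'
  have h2 : F - comb g b L a = (F - comb g b L (y s)) - (p : R) ^ s • comb g b L a' := by
    rw [← map_smul, ← h1, map_sub]
    abel
  rw [h2, map_sub, hE, map_smul]
  exact dvd_sub (dvd_mul_right _ _) (dvd_mul_right _ _)

/-- The matrix of the Cartier operator, with an error term that is `p` times a derivative. -/
theorem IsFrame.exists_cartier_matrix (h : IsFrame Δ μ b l) (hp : p.Prime) (hp2 : 2 < p)
    (hσ : ∀ r : R, (p : R) ∣ σ r - r ^ p) (hL : ∀ u, u ∈ L ↔ toReal u ∈ μ)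
    (hg : Adapted Δ b l g) (hW : IsUnit (hasseWitt g L p)) :
    ∃ Λ : Matrix L L R, (∀ u v, (p : R) ∣ hasseWitt g L p u v - Λ u v) ∧
      ∀ u : L, ∃ e ∈ dFormal R Δ b, cartierHom R n p (omega g b 1 (u : Fin n → ℤ)) =
        comb (twist σ g) b L (Λ u) + (p : R) • e := by
  have h1 : ∀ u : L, ∃ v : L → R, ∃ e ∈ dFormal R Δ b,
      cartierHom R n p (omega g b 1 (u : Fin n → ℤ)) =
        comb (twist σ g) b L (hasseWitt g L p u + (p : R) • v) + (p : R) • e := by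
    intro u
    obtain ⟨F', hF', e⟩ := h.cartier_comb hp hp2 hσ hg hL (Pi.single u 1)
    -- Decomposing the remainder before multiplying by `p` shows that the error is `p` times a
    -- derivative, one power better than the definition of `Λ_σ` demands.
    obtain ⟨v, hv⟩ := h.exists_sub_comb_mem_dFormal hp hp2 hσ hL (hg.twist σ)
      (isUnit_hasseWitt_twist σ hW) hF'
    refine ⟨v, _, hv, ?_⟩
    have h2 : comb g b L (Pi.single u 1) = omega g b 1 (u : Fin n → ℤ) := by
      rw [comb, Fintype.linearCombination_apply_single, one_smul]
    rw [h2, Matrix.single_one_vecMul] at e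
    have h3 : (hasseWitt g L p).row u = hasseWitt g L p u := rfl
    rw [e, h3, map_add, map_smul]
    module
  choose v e he hv using h1
  refine ⟨Matrix.of fun u => hasseWitt g L p u + (p : R) • v u, fun u w => ?_, fun u =>
    ⟨e u, he u, hv u⟩⟩
  simp

end Decomposition

/-! ### Periods and the Dwork congruences -/

section Period

variable {R : Type*} [CommRing R] {n : ℕ} {p : ℕ} {σ : R →+* R}
  {Δ μ : Set (Fin n → ℝ)} {b : Fin n → ℤ} {l : (Fin n → ℤ) →+ ℝ} {L : Finset (Fin n → ℤ)}
  {g : Laurent R n}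

theorem dvd_period {q : R} {F : (Fin n → ℤ) → R} (hF : ∀ k, q ∣ F k) (m : ℕ) (v : Fin n → ℤ) :
    q ∣ period g m v F := dvd_act _ hF _

/-- Replace `g ^ (m p ^ (s + 1))` by `g^σ(x ^ p) ^ (m p ^ s)` modulo `p ^ (s + 1)`, then apply the
projection formula. -/
theorem pow_dvd_period_sub (hp : p.Prime) (hσ : ∀ r : R, (p : R) ∣ σ r - r ^ p)
    (g : Laurent R n) (m s : ℕ) (v : Fin n → ℤ) (F : (Fin n → ℤ) → R) :
    (p : R) ^ (s + 1) ∣ period g (m * p ^ (s + 1)) v F -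
      period (twist σ g) (m * p ^ s) v (cartierHom R n p F) := by
  obtain ⟨X, hX⟩ := natCast_pow_dvd_pow_sub_frob hp hσ g m s
  have h1 : ((m * p ^ (s + 1)) • v : Fin n → ℤ) = p • (m * p ^ s) • v := by
    rw [smul_smul]
    congr 1
    ring
  rw [sub_eq_iff_eq_add', ← Nat.cast_pow, ← nsmul_eq_mul] at hX
  rw [period_apply, hX, map_add, LinearMap.add_apply, Pi.add_apply, h1,
    ← cartierHom_apply p (act _ F) ((m * p ^ s) • v),
    cartierHom_act, ← period_apply, add_sub_cancel_left, map_nsmul, LinearMap.smul_apply,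
    Pi.smul_apply, nsmul_eq_mul, Nat.cast_pow]
  exact dvd_mul_right _ _

/-- Each comparison lowers the level `s` by one and applies `C` once, which raises the known
divisibility `e` by one; the sum is unchanged. Taking `p ^ e` out of `F` beforehand makes the
comparison itself valid modulo `p ^ (e + s)`. -/
theorem pow_dvd_period_of_dvd_cartier (hp : p.Prime) (hσ : ∀ r : R, (p : R) ∣ σ r - r ^ p)
    (m s : ℕ) (v : Fin n → ℤ) : ∀ (e : ℕ) (g : Laurent R n) {F : (Fin n → ℤ) → R},
      (∀ j ≤ s, ∀ k, (p : R) ^ (e + j) ∣ (cartierHom R n p ^ j) F k) →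
      (p : R) ^ (e + s) ∣ period g (m * p ^ s) v F := by
  induction s with
  | zero => exact fun e g F hF => dvd_period (hF 0 le_rfl) _ _
  | succ s ih =>
    intro e g F hF
    obtain ⟨F₀, rfl⟩ := exists_eq_smul_of_dvd (hF 0 (Nat.zero_le _))
    have h1 : (p : R) ^ (e + (s + 1)) ∣ period g (m * p ^ (s + 1)) v ((p : R) ^ (e + 0) • F₀) -
        period (twist σ g) (m * p ^ s) v (cartierHom R n p ((p : R) ^ (e + 0) • F₀)) := by
      rw [map_smul, map_smul, map_smul, ← smul_sub, smul_eq_mul, pow_add, add_zero]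
      exact mul_dvd_mul_left _ (pow_dvd_period_sub hp hσ g m s v F₀)
    have h2 := ih (e + 1) (twist σ g) (F := cartierHom R n p ((p : R) ^ (e + 0) • F₀))
      fun j hj k => by
        rw [← Module.End.mul_apply, ← pow_succ, add_right_comm, add_assoc]
        exact hF (j + 1) (by omega) k
    rw [add_right_comm, add_assoc] at h2
    exact (dvd_sub_left h2).mp h1

/-- The periods of a formal derivative are divisible by powers of `p`. -/
theorem pow_dvd_period_of_mem_dFormal (hp : p.Prime) (hσ : ∀ r : R, (p : R) ∣ σ r - r ^ p)
    (g : Laurent R n) (m s : ℕ) (v : Fin n → ℤ) {F : (Fin n → ℤ) → R}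
    (hF : F ∈ dFormal R Δ b) : (p : R) ^ s ∣ period g (m * p ^ s) v F := by
  have := pow_dvd_period_of_dvd_cartier hp hσ m s v 0 g (F := F) fun j _ k => by
    rw [zero_add]
    exact pow_dvd_cartier_of_mem_dFormal hF j k
  rwa [zero_add] at this

/-- Take periods of the expression for `C ω_u`. The error contributes `p` times the period of a
derivative at level `s`, hence a multiple of `p ^ (s + 1)`. -/
theorem pow_dvd_hasseWitt_sub_mul (hp : p.Prime) (hσ : ∀ r : R, (p : R) ∣ σ r - r ^ p)
    (hg : Adapted Δ b l g) {Λ : Matrix L L R}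
    (hΛ : ∀ u : L, ∃ e ∈ dFormal R Δ b, cartierHom R n p (omega g b 1 (u : Fin n → ℤ)) =
        comb (twist σ g) b L (Λ u) + (p : R) • e)
    {m : ℕ} (hm : 0 < m) (s : ℕ) (u v : L) :
    (p : R) ^ (s + 1) ∣ hasseWitt g L (m * p ^ (s + 1)) u v -
      (Λ * hasseWitt (twist σ g) L (m * p ^ s)) u v := by
  obtain ⟨e, he, hu⟩ := hΛ u
  have hpos : ∀ s, 0 < m * p ^ s := fun s => Nat.mul_pos hm (pow_pos hp.pos s)
  have h1 := pow_dvd_period_sub hp hσ g m s v (omega g b 1 (u : Fin n → ℤ))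
  rw [period_omega hg.leading (hpos _), hu, map_add, period_comb (hg.twist σ).leading (hpos _),
    map_smul, ← sub_sub] at h1
  refine (dvd_sub_left ?_).mp h1
  rw [pow_succ', smul_eq_mul]
  exact mul_dvd_mul_left _ (pow_dvd_period_of_mem_dFormal hp hσ _ m s v he)

end Period

/-! ### Lifting invertibility of matrices from `R / p` -/

section Unit

variable {R : Type*} [CommRing R] {p : ℕ} [IsAdicComplete (Ideal.span {(p : R)}) R]

theorem isUnit_matrix_of_dvd_sub {ι : Type*} [Fintype ι] [DecidableEq ι] {A B : Matrix ι ι R}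
    (hA : IsUnit A) (h : ∀ u v, (p : R) ∣ A u v - B u v) : IsUnit B := by
  rw [Matrix.isUnit_iff_isUnit_det] at hA ⊢
  refine isUnit_of_dvd_sub p hA ?_
  rw [← Ideal.mem_span_singleton, ← Ideal.Quotient.eq, RingHom.map_det, RingHom.map_det]
  congr 1
  ext u v
  exact Ideal.Quotient.eq.mpr (Ideal.mem_span_singleton.mpr (h u v))

end Unit

/-! ### Derivations of the coefficient ring -/

section Connection

variable {R : Type*} [CommRing R] {n : ℕ} (δ : Derivation ℤ R R)

/-- A derivation of `R`, applied to the coefficients of Laurent polynomials. -/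
def polyDeriv : Derivation ℤ (Laurent R n) (Laurent R n) :=
  Derivation.mk' (AddMonoidHom.toIntLinearMap
    (AddMonoidAlgebra.coeffAddEquiv.symm.toAddMonoidHom.comp
      ((Finsupp.mapRange.addMonoidHom δ.toLinearMap.toAddMonoidHom).comp
        AddMonoidAlgebra.coeffAddEquiv.toAddMonoidHom))) (by
    have hs : ∀ (a : Fin n → ℤ) (r : R), (AddMonoidAlgebra.coeffAddEquiv.symm.toAddMonoidHom.comp
        ((Finsupp.mapRange.addMonoidHom δ.toLinearMap.toAddMonoidHom).comp
          AddMonoidAlgebra.coeffAddEquiv.toAddMonoidHom)) (AddMonoidAlgebra.single a r) =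
        AddMonoidAlgebra.single a (δ r) := by
      intro a r
      simp
    intro P Q
    simp only [AddMonoidHom.coe_toIntLinearMap, smul_eq_mul]
    induction P using AddMonoidAlgebra.induction_linear with
    | zero => simp only [zero_mul, map_zero, mul_zero, add_zero]
    | add P₁ P₂ h₁ h₂ =>
      rw [add_mul, map_add, h₁, h₂, map_add]
      ring
    | single a r =>
      induction Q using AddMonoidAlgebra.induction_linear with
      | zero => simp only [zero_mul, map_zero, mul_zero, add_zero]
      | add P₁ P₂ h₁ h₂ =>
        rw [mul_add, map_add, h₁, h₂, map_add]
        ring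
      | single c t =>
        rw [AddMonoidAlgebra.single_mul_single, hs, hs, hs, AddMonoidAlgebra.single_mul_single,
          AddMonoidAlgebra.single_mul_single, Derivation.leibniz, AddMonoidAlgebra.single_add,
          add_comm c a, smul_eq_mul, smul_eq_mul])

theorem polyDeriv_coeff (P : Laurent R n) (a : Fin n → ℤ) :
    (polyDeriv δ P).coeff a = δ (P.coeff a) := rfl

/-- The action of a derivation on formal series as an additive map. -/
def connectionHom : ((Fin n → ℤ) → R) →+ ((Fin n → ℤ) → R) where
  toFun := connection δ
  map_zero' := funext fun _ => map_zero δ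
  map_add' _ _ := funext fun _ => map_add δ _ _

theorem connectionHom_apply (F : (Fin n → ℤ) → R) (k : Fin n → ℤ) :
    connectionHom δ F k = δ (F k) := rfl

theorem connectionHom_smul (r : R) (F : (Fin n → ℤ) → R) :
    connectionHom δ (r • F) = r • connectionHom δ F + δ r • F := by
  ext k
  simp only [connectionHom_apply, Pi.add_apply, Pi.smul_apply, smul_eq_mul, Derivation.leibniz]
  ring

theorem connectionHom_act (P : Laurent R n) (F : (Fin n → ℤ) → R) :
    connectionHom δ (act P F) = act (polyDeriv δ P) F + act P (connectionHom δ F) := by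
  induction P using AddMonoidAlgebra.induction_linear with
  | zero => simp
  | add P₁ P₂ h₁ h₂ =>
    simp only [map_add, LinearMap.add_apply, h₁, h₂]
    abel
  | single a r =>
    have hs : polyDeriv δ (AddMonoidAlgebra.single a r : Laurent R n) =
        AddMonoidAlgebra.single a (δ r) := by
      ext k
      classical
      rw [polyDeriv_coeff, AddMonoidAlgebra.coeff_single, AddMonoidAlgebra.coeff_single,
        Finsupp.single_apply, Finsupp.single_apply]
      split_ifs <;> simp
    ext k
    rw [hs, Pi.add_apply, connectionHom_apply, act_single, act_single, act_single,
      connectionHom_apply, Derivation.leibniz, smul_eq_mul, smul_eq_mul]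
    ring

theorem low_connection {l : (Fin n → ℤ) →+ ℝ} {F : (Fin n → ℤ) → R} (hF : Low l F) :
    Low l (connectionHom δ F) := by
  obtain ⟨c, hc⟩ := hF
  refine ⟨c, fun k hk => hc k fun h => hk ?_⟩
  rw [connectionHom_apply, h, map_zero]

variable {p : ℕ} {Δ μ : Set (Fin n → ℝ)} {b : Fin n → ℤ} {l : (Fin n → ℤ) →+ ℝ}
  {g : Laurent R n}

theorem IsFrame.connection_mem_Omega (h : IsFrame Δ μ b l) (hg : Adapted Δ b l g)
    {F : (Fin n → ℤ) → R} (hF : F ∈ Omega g b μ) : connectionHom δ F ∈ Omega g b μ := by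
  induction hF using Submodule.span_induction with
  | zero => rw [map_zero]; exact zero_mem _
  | add F G _ _ hF hG => rw [map_add]; exact add_mem hF hG
  | smul r F hF hF' =>
    rw [connectionHom_smul]
    exact add_mem (Submodule.smul_mem _ _ hF') (Submodule.smul_mem _ _ hF)
  | mem F hF =>
    obtain ⟨d, u, hd, hu, rfl⟩ := hF
    set F := omega g b d u with hF
    -- The quotient rule gives `δ ω_(d, u) = -d! x ^ u δ(g) / g ^ (d + 1)`; the factorial is the one
    -- required at pole order `d + 1`.
    have h1 : act (g ^ (d + 1)) (connectionHom δ F) = ((d + 1 - 1).factorial : R) •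
        ⇑(-(AddMonoidAlgebra.single u 1 * polyDeriv δ g) : Laurent R n).coeff := by
      have h2 := connectionHom_act δ (g ^ d) F
      have h3 : connectionHom δ (act (g ^ d) F) = 0 := by
        ext k
        classical
        rw [act_omega hg.leading, connectionHom_apply, AddMonoidAlgebra.coeff_single,
          Finsupp.single_apply]
        split_ifs <;> simp
      have h4 : g * polyDeriv δ (g ^ d) = (d : Laurent R n) * (polyDeriv δ g * g ^ d) := by
        obtain ⟨d', rfl⟩ := Nat.exists_eq_succ_of_ne_zero hd.ne'
        rw [Derivation.leibniz_pow, Nat.succ_sub_one, nsmul_eq_mul, smul_eq_mul, Nat.succ_eq_add_one,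
          pow_succ g d']
        ring
      have h5 : act (g ^ (d + 1)) (connectionHom δ F) = -act (g * polyDeriv δ (g ^ d)) F := by
        rw [h3] at h2
        rw [pow_succ', act_mul, act_mul, eq_neg_of_add_eq_zero_right h2.symm, map_neg]
      have h6 : ((d : R) * ((d - 1).factorial : R)) = ((d + 1 - 1).factorial : R) := by
        rw [Nat.add_sub_cancel, ← Nat.mul_factorial_pred hd.ne']
        push_cast
        rfl
      have h7 : (d : Laurent R n) * (polyDeriv δ g * AddMonoidAlgebra.single u ((d - 1).factorial : R))
          = ((d + 1 - 1).factorial : R) • (AddMonoidAlgebra.single u 1 * polyDeriv δ g) := by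
        rw [← h6, mul_smul, ← smul_mul_assoc, AddMonoidAlgebra.smul_single, smul_eq_mul, mul_one,
          Nat.cast_smul_eq_nsmul, nsmul_eq_mul]
        ring
      rw [h5, h4, ← mul_assoc, act_mul, act_omega hg.leading, act_coeff, mul_assoc, h7]
      ext k
      simp
    rw [eq_omegaPoly hg.leading (low_connection δ (low_omega hg.leading d u)) h1]
    refine omegaPoly_mem (Nat.succ_pos d) fun w hw => ?_
    rw [AddMonoidAlgebra.coeff_neg, Finsupp.neg_apply, neg_ne_zero,
      AddMonoidAlgebra.coeff_single_mul_apply, one_mul, polyDeriv_coeff] at hw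
    have h2 : g.coeff (-u + w) ≠ 0 := fun h0 => hw (by rw [h0, map_zero])
    have h3 := h.absorb_dilate hd hu (inDilate_one.mpr (hg.support _ h2))
    rwa [add_neg_cancel_left] at h3

theorem IsFrame.connection_mem_hat (h : IsFrame Δ μ b l) (hg : Adapted Δ b l g)
    {F : (Fin n → ℤ) → R} (hF : F ∈ hat p g b μ) : connectionHom δ F ∈ hat p g b μ :=
  map_mem_hat _ (fun _ hw => Omega_le_hat (h.connection_mem_Omega δ hg hw)) hF

/-- `δ` commutes with `C` and preserves divisibility by `p ^ s`, so the Cartier criterion is stable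
under it. -/
theorem connection_mem_dFormal [IsDomain R] [CharZero R] [IsAdicComplete (Ideal.span {(p : R)}) R]
    (hp : p.Prime) {F : (Fin n → ℤ) → R} (hF : F ∈ dFormal R Δ b) :
    connectionHom δ F ∈ dFormal R Δ b := by
  refine (mem_dFormal_iff hp).mpr ⟨fun k hk => dFormal_le_formal hF k fun h0 => hk ?_,
    fun s k => ?_⟩
  · rw [connectionHom_apply, h0, map_zero]
  · have h1 : (cartierHom R n p ^ s) (connectionHom δ F) =
        connectionHom δ ((cartierHom R n p ^ s) F) := by
      ext k
      rw [cartierHom_pow_apply, connectionHom_apply, connectionHom_apply, cartierHom_pow_apply]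
    rw [h1]
    exact dvd_map_of_dvd _ (pow_dvd_cartier_of_mem_dFormal hF s) k

/-- By Leibniz the difference involves only `δ (g ^ (m p ^ s))`, which has the factor `m p ^ s`. -/
theorem pow_dvd_period_connection_sub (m s : ℕ) (v : Fin n → ℤ) (F : (Fin n → ℤ) → R) :
    (p : R) ^ s ∣ δ (period g (m * p ^ s) v F) -
      period g (m * p ^ s) v (connectionHom δ F) := by
  rw [period_apply, ← connectionHom_apply, connectionHom_act, Pi.add_apply, ← period_apply,
    add_sub_cancel_right, Derivation.leibniz_pow, map_nsmul, LinearMap.smul_apply, Pi.smul_apply,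
    nsmul_eq_mul]
  push_cast
  exact ((dvd_mul_left _ _).mul_right _)

end Connection

/-! ### Convex geometry of the Newton polytope -/

section Geometry

variable {R : Type*} [CommRing R] {n : ℕ}

/-- A face containing an interior point of a segment in `Δ` contains its endpoints. If the point lay
in the complement of `μ`, so would `w`. -/
theorem IsFaceOpen.absorb {Δ μ : Set (Fin n → ℝ)} (h : IsFaceOpen Δ μ) (hΔ : Convex ℝ Δ)
    {w w' : Fin n → ℝ} (hw : w ∈ μ) (hw' : w' ∈ Δ) {s t : ℝ} (hs : 0 < s) (ht : 0 ≤ t)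
    (hst : s + t = 1) : s • w + t • w' ∈ μ := by
  obtain ⟨hμ, S, hS, hSμ⟩ := h
  by_contra hz
  rcases ht.eq_or_lt with rfl | ht0
  · obtain rfl : s = 1 := by linarith
    simp [hw] at hz
  have h1 : s • w + t • w' ∈ ⋃₀ S := by
    rw [← hSμ]
    exact ⟨hΔ (hμ hw) hw' hs.le ht hst, hz⟩
  obtain ⟨A, hA, hzA⟩ := h1
  have h2 : w ∈ A := (hS A hA).isExtreme.left_mem_of_mem_openSegment (hμ hw) hw' hzA
    ⟨s, t, hs, ht0, hst, rfl⟩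
  have h3 : w ∈ Δ \ μ := by
    rw [hSμ]
    exact ⟨A, hA, h2⟩
  exact h3.2 hw

/-- A vertex of the Newton polytope is the strict minimum of a linear functional. -/
theorem exists_functional {f : Laurent R n} {b : Fin n → ℤ} (hb : IsVertex (newton f) b) :
    ∃ (φ : (Fin n → ℝ) →ₗ[ℝ] ℝ), (∀ a ∈ f.coeff.support, a ≠ b →
      φ (toReal b) + 1 ≤ φ (toReal a)) ∧ ∀ w ∈ newton f, φ (toReal b) ≤ φ w := by
  set T : Set (Fin n → ℝ) := toReal '' (f.coeff.support \ {b} : Set (Fin n → ℤ)) with hT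
  have hinj : Function.Injective (toReal (n := n)) := by
    intro k k' h
    ext i
    have := congrFun h i
    simpa [toReal] using this
  have hTf : T.Finite := (f.coeff.support.finite_toSet.subset Set.sdiff_subset).image _
  have hbT : toReal b ∉ convexHull ℝ T := by
    have h1 := ((convex_convexHull ℝ _).mem_extremePoints_iff_mem_sdiff_convexHull_sdiff.mp hb).2
    refine fun h2 => h1 (convexHull_mono ?_ h2)
    rintro _ ⟨a, ⟨ha, hab⟩, rfl⟩
    exact ⟨subset_convexHull ℝ _ ⟨a, ha, rfl⟩, fun h3 => hab (hinj h3)⟩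
  -- Being extreme, `b` is outside the compact convex hull of the other exponents, so Hahn–Banach
  -- separates them.
  obtain ⟨φ, u, hφb, hφ⟩ := geometric_hahn_banach_point_closed (convex_convexHull ℝ T)
    (hTf.isCompact_convexHull ℝ).isClosed hbT
  have hpos : 0 < u - φ (toReal b) := by linarith
  have h1 : ∀ a ∈ f.coeff.support, a ≠ b → u < φ (toReal a) := fun a ha hab =>
    hφ _ (subset_convexHull ℝ _ ⟨a, ⟨ha, hab⟩, rfl⟩)
  -- Rescaling turns the separation gap into 1, the step used in the inductions on weight.
  refine ⟨(u - φ (toReal b))⁻¹ • φ.toLinearMap, fun a ha hab => ?_, fun w hw => ?_⟩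
  · have := h1 a ha hab
    simp only [LinearMap.smul_apply, smul_eq_mul, ContinuousLinearMap.coe_coe]
    rw [← le_sub_iff_add_le', ← mul_sub, ← inv_mul_cancel₀ hpos.ne']
    exact mul_le_mul_of_nonneg_left (by linarith) (inv_nonneg.mpr hpos.le)
  · simp only [LinearMap.smul_apply, smul_eq_mul, ContinuousLinearMap.coe_coe]
    refine mul_le_mul_of_nonneg_left ?_ (inv_nonneg.mpr hpos.le)
    have h2 : newton f ⊆ {w | φ (toReal b) ≤ φ w} := by
      refine convexHull_min ?_ (convex_halfSpace_ge φ.toLinearMap.isLinear _)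
      rintro _ ⟨a, ha, rfl⟩
      by_cases hab : a = b
      · simp [hab]
      · exact (hφb.trans (h1 a ha hab)).le
    exact h2 hw

theorem exists_frame {f : Laurent R n} {b : Fin n → ℤ} (hb : IsVertex (newton f) b)
    (hfb : IsUnit (f.coeff b)) {μ : Set (Fin n → ℝ)} (hμ : IsFaceOpen (newton f) μ) :
    ∃ l : (Fin n → ℤ) →+ ℝ, IsFrame (newton f) μ b l ∧ Adapted (newton f) b l f := by
  obtain ⟨φ, h1, h2⟩ := exists_functional hb
  refine ⟨AddMonoidHom.mk' (fun k => φ (toReal k)) fun a c => by rw [toReal_add, map_add],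
    ⟨convex_convexHull ℝ _, hb.1, hμ.1, fun w hw w' hw' s t hs ht hst =>
      hμ.absorb (convex_convexHull ℝ _) hw hw' hs ht hst, ?_⟩, ⟨hfb, h1⟩, fun a ha =>
      subset_convexHull ℝ _ ⟨a, Finsupp.mem_support_iff.mpr ha, rfl⟩⟩
  rintro k ⟨w, hw, t, ht, e⟩
  change 0 ≤ φ (toReal k)
  rw [e, map_smul, map_sub, smul_eq_mul]
  exact mul_nonneg ht (sub_nonneg.mpr (h2 w hw))

theorem mem_lattice {f : Laurent R n} {μ : Set (Fin n → ℝ)} (hμ : μ ⊆ newton f)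
    (u : Fin n → ℤ) : u ∈ lattice f μ ↔ toReal u ∈ μ := by
  rw [lattice, Set.Finite.mem_toFinset]
  exact ⟨fun h => h.2, fun h => ⟨hμ h, h⟩⟩

end Geometry

/-! ### From formal series back to the completed modules -/

section Transfer

variable {R : Type*} [CommRing R] {n : ℕ} {p : ℕ} [IsAdicComplete (Ideal.span {(p : R)}) R]
  {g g' : Laurent R n} {b : Fin n → ℤ} {μ Δ : Set (Fin n → ℝ)} {l : (Fin n → ℤ) →+ ℝ}
  {L : Finset (Fin n → ℤ)}

theorem toFormal_of (w : Omega g b μ) :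
    toFormal p g b μ (AdicCompletion.of (Ideal.span {(p : R)}) (Omega g b μ) w) = w := by
  ext k
  change (AdicCompletion.ofLinearEquiv (Ideal.span {(p : R)}) R).symm
    (AdicCompletion.map (Ideal.span {(p : R)}) _ (AdicCompletion.of _ _ w)) = _
  rw [AdicCompletion.map_of, AdicCompletion.ofLinearEquiv_symm_of]
  rfl

theorem pow_dvd_toFormal_mk_sub
    (a : AdicCompletion.AdicCauchySequence (Ideal.span {(p : R)}) (Omega g b μ)) (N : ℕ)
    (k : Fin n → ℤ) :
    (p : R) ^ N ∣ toFormal p g b μ (AdicCompletion.mk _ _ a) k -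
      ((a N : Omega g b μ) : (Fin n → ℤ) → R) k := by
  set r := toFormal p g b μ (AdicCompletion.mk _ _ a) k with hr
  have h1 : AdicCompletion.of (Ideal.span {(p : R)}) R r =
      AdicCompletion.map (Ideal.span {(p : R)})
        ((LinearMap.proj k : ((Fin n → ℤ) → R) →ₗ[R] R) ∘ₗ (Omega g b μ).subtype)
        (AdicCompletion.mk _ _ a) :=
    AdicCompletion.of_ofLinearEquiv_symm _ _
  rw [AdicCompletion.map_mk] at h1
  have h2 := congrArg (fun x => AdicCompletion.eval (Ideal.span {(p : R)}) R N x) h1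
  exact (smodEq_iff_dvd p N _ _).mp h2

theorem toFormal_mem_hat (ω : OmegaHat p g b μ) : toFormal p g b μ ω ∈ hat p g b μ := by
  obtain ⟨a, rfl⟩ := AdicCompletion.mk_surjective (Ideal.span {(p : R)}) (Omega g b μ) ω
  have h1 : ∀ N, ∃ z : Omega g b μ, a (N + 1) - a N = (p : R) ^ N • z := by
    exact fun N => (mem_span_natCast_pow_smul_top p N _).mp
      (SModEq.sub_mem.mp (a.2 (Nat.le_succ N)).symm)
  choose z hz using h1
  refine ⟨fun N => (a N : Omega g b μ), fun N => z N, fun N => (a N).2, fun N => (z N).2,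
    fun N k => pow_dvd_toFormal_mk_sub a N k, fun N => ?_⟩
  have := congrArg (fun x : Omega g b μ => (x : (Fin n → ℤ) → R)) (hz N)
  dsimp only at this ⊢
  rw [← sub_eq_iff_eq_add']
  exact this

/-- Together with `toFormal_mem_hat` this makes `hat` exactly the image of the completion.
Injectivity of the expansion is not required, as its kernel lies in `formalExact`. -/
theorem exists_toFormal_eq {F : (Fin n → ℤ) → R} (hF : F ∈ hat p g b μ) :
    ∃ ω : OmegaHat p g b μ, toFormal p g b μ ω = F := by
  obtain ⟨y, z, hy, hz, hF, hyz⟩ := hF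
  let a : AdicCompletion.AdicCauchySequence (Ideal.span {(p : R)}) (Omega g b μ) :=
    AdicCompletion.AdicCauchySequence.mk (Ideal.span {(p : R)}) (Omega g b μ)
      (fun N => ⟨y N, hy N⟩) fun N => by
        refine SModEq.symm (SModEq.sub_mem.mpr ?_)
        rw [mem_span_natCast_pow_smul_top]
        refine ⟨⟨z N, hz N⟩, Subtype.ext ?_⟩
        change y (N + 1) - y N = (p : R) ^ N • z N
        rw [hyz, add_sub_cancel_left]
  refine ⟨AdicCompletion.mk _ _ a, ?_⟩
  ext k
  rw [← sub_eq_zero]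
  refine eq_zero_of_forall_pow_dvd p fun N => ?_
  rw [← sub_sub_sub_cancel_right _ _ (y N k)]
  exact dvd_sub (pow_dvd_toFormal_mk_sub a N k) (hF N k)

theorem crystalMk_eq_sum_iff (hL : ∀ u ∈ L, toReal u ∈ μ) (ω : OmegaHat p g b μ) (a : L → R) :
    crystalMk p Δ g b μ ω = ∑ u, a u • omegaClass p Δ g b μ u (hL u u.2) ↔
      toFormal p g b μ ω - comb g b L a ∈ dFormal R Δ b := by
  have h1 : ∑ u, a u • omegaClass p Δ g b μ u (hL u u.2) = crystalMk p Δ g b μ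
      (∑ u : L, a u • AdicCompletion.of (Ideal.span {(p : R)}) (Omega g b μ)
        (omegaOne g b μ u (hL u u.2))) := by
    rw [map_sum]
    exact Finset.sum_congr rfl fun u _ => (map_smul _ _ _).symm
  rw [h1, crystalMk, Submodule.mkQ_apply, Submodule.mkQ_apply, Submodule.Quotient.eq]
  change toFormal p g b μ _ ∈ dFormal R Δ b ↔ _
  rw [map_sub, map_sum, comb_apply]
  simp_rw [map_smul, toFormal_of]
  rfl

theorem IsFrame.exists_basis [IsDomain R] [CharZero R] {σ : R →+* R} (h : IsFrame Δ μ b l)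
    (hp : p.Prime) (hp2 : 2 < p) (hσ : ∀ r : R, (p : R) ∣ σ r - r ^ p)
    (hL : ∀ u, u ∈ L ↔ toReal u ∈ μ) (hg : Adapted Δ b l g) (hW : IsUnit (hasseWitt g L p)) :
    ∃ B : Module.Basis L R (Crystal p Δ g b μ),
      ∀ u, B u = omegaClass p Δ g b μ u ((hL u).mp u.2) := by
  have hL' : ∀ u ∈ L, toReal u ∈ μ := fun u hu => (hL u).mp hu
  refine ⟨Module.Basis.mk (v := fun u : L => omegaClass p Δ g b μ u (hL' u u.2)) ?_ ?_,
    fun u => Module.Basis.mk_apply _ _ u⟩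
  · rw [Fintype.linearIndependent_iff]
    intro a ha u
    have h1 := (crystalMk_eq_sum_iff (p := p) (Δ := Δ) hL' 0 a).mp (by rw [ha, map_zero])
    rw [map_zero, zero_sub] at h1
    exact congrFun (h.eq_zero_of_comb_mem_dFormal hp hp2 hσ hL hg hW (neg_mem_iff.mp h1)) u
  · intro x _
    obtain ⟨ω, rfl⟩ := Submodule.mkQ_surjective _ x
    obtain ⟨a, ha⟩ := h.exists_sub_comb_mem_dFormal hp hp2 hσ hL hg hW (toFormal_mem_hat ω)
    have h1 := (crystalMk_eq_sum_iff hL' ω a).mpr ha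
    rw [crystalMk] at h1
    rw [h1]
    exact Submodule.sum_mem _ fun u _ => Submodule.smul_mem _ _ (Submodule.subset_span ⟨u, rfl⟩)

theorem crystalMk_eq_basis_sum_iff (hL : ∀ u ∈ L, toReal u ∈ μ)
    {B : Module.Basis L R (Crystal p Δ g b μ)}
    (hB : ∀ u, B u = omegaClass p Δ g b μ u (hL u u.2)) (ω : OmegaHat p g b μ) (a : L → R) :
    crystalMk p Δ g b μ ω = ∑ u, a u • B u ↔
      toFormal p g b μ ω - comb g b L a ∈ dFormal R Δ b := by
  simp_rw [hB]
  exact crystalMk_eq_sum_iff hL ω a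

/-- A map on the quotients that is given on classes by coefficients is induced by the operator `T`
if `T` has the same coefficients up to formal derivatives. -/
theorem isInducedBy_of_coeff (hL : ∀ u ∈ L, toReal u ∈ μ)
    {B : Module.Basis L R (Crystal p Δ g b μ)}
    (hB : ∀ u, B u = omegaClass p Δ g b μ u (hL u u.2))
    {B' : Module.Basis L R (Crystal p Δ g' b μ)}
    (hB' : ∀ u, B' u = omegaClass p Δ g' b μ u (hL u u.2))
    {T : ((Fin n → ℤ) → R) →+ ((Fin n → ℤ) → R)}
    (hT : ∀ F ∈ hat p g b μ, T F ∈ hat p g' b μ)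
    (hT' : ∀ F ∈ dFormal R Δ b, T F ∈ dFormal R Δ b)
    {Φ : Crystal p Δ g b μ → Crystal p Δ g' b μ} (c : (L → R) → L → R)
    (hΦ : ∀ a, Φ (∑ u, a u • B u) = ∑ w, c a w • B' w)
    (hc : ∀ a, T (comb g b L a) - comb g' b L (c a) ∈ dFormal R Δ b) :
    IsInducedBy p Δ g g' b μ T Φ := by
  intro ω
  obtain ⟨η, hη⟩ := exists_toFormal_eq (hT _ (toFormal_mem_hat ω))
  refine ⟨η, hη, ?_⟩
  have h1 := (B.sum_repr (crystalMk p Δ g b μ ω)).symm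
  rw [h1, hΦ]
  refine ((crystalMk_eq_basis_sum_iff hL hB' η _).mpr ?_).symm
  have h2 := hT' _ ((crystalMk_eq_basis_sum_iff hL hB ω _).mp h1)
  rw [map_sub] at h2
  rw [hη]
  have := add_mem h2 (hc (B.repr (crystalMk p Δ g b μ ω)))
  rwa [sub_add_sub_cancel] at this

end Transfer

/-! ### Congruences and matrices for the main theorem -/

section Main

variable {R : Type*} [CommRing R] {n : ℕ} {p : ℕ} {Δ μ : Set (Fin n → ℝ)} {b : Fin n → ℤ}
  {l : (Fin n → ℤ) →+ ℝ} {L : Finset (Fin n → ℤ)} {g : Laurent R n}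

theorem MatCongr.mul_inv {ι : Type*} [Fintype ι] [DecidableEq ι] {s : ℕ} {A X M : Matrix ι ι R}
    (h : MatCongr p s A (X * M)) (hM : IsUnit M) : MatCongr p s X (A * M⁻¹) := by
  intro u v
  have h1 : X - A * M⁻¹ = -((A - X * M) * M⁻¹) := by
    rw [Matrix.sub_mul, Matrix.mul_assoc,
      Matrix.mul_nonsing_inv _ ((Matrix.isUnit_iff_isUnit_det M).mp hM), Matrix.mul_one, neg_sub]
  rw [← Matrix.sub_apply, h1, Matrix.neg_apply, dvd_neg, Matrix.mul_apply]
  exact Finset.dvd_sum fun w _ => (h u w).mul_right _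

theorem comb_vecMul (A : Matrix L L R) (a : L → R) :
    comb g b L (Matrix.vecMul a A) = ∑ u, a u • comb g b L (A u) := by
  rw [Matrix.vecMul_eq_sum, map_sum]
  exact Finset.sum_congr rfl fun u _ => map_smul _ _ _

theorem sum_vecMul_smul {M : Type*} [AddCommGroup M] [Module R M] {ι : Type*} [Fintype ι]
    (A : Matrix ι ι R) (a : ι → R) (x : ι → M) :
    ∑ w, Matrix.vecMul a A w • x w = ∑ u, a u • ∑ w, A u w • x w := by
  simp_rw [Matrix.vecMul, dotProduct, Finset.sum_smul, Finset.smul_sum, smul_smul]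
  exact Finset.sum_comm

theorem matCongr_connection {σ : R →+* R} (hp : p.Prime) (hσ : ∀ r : R, (p : R) ∣ σ r - r ^ p)
    (hg : Adapted Δ b l g) {δ : Derivation ℤ R R} {N : Matrix L L R}
    (hN : ∀ u : L, connectionHom δ (omega g b 1 (u : Fin n → ℤ)) - comb g b L (N u) ∈
      dFormal R Δ b) {m : ℕ} (hm : 0 < m) (s : ℕ) :
    MatCongr p s ((hasseWitt g L (m * p ^ s)).map δ) (N * hasseWitt g L (m * p ^ s)) := by
  intro u v
  have hpos : 0 < m * p ^ s := Nat.mul_pos hm (pow_pos hp.pos s)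
  have h1 := pow_dvd_period_connection_sub δ (g := g) (p := p) m s v
    (omega g b 1 (u : Fin n → ℤ))
  have h2 := pow_dvd_period_of_mem_dFormal hp hσ g m s v (hN u)
  rw [map_sub, period_comb hg.leading hpos] at h2
  have := dvd_add h1 h2
  rw [sub_add_sub_cancel, period_omega hg.leading hpos] at this
  exact this

variable [IsDomain R] [CharZero R] [IsAdicComplete (Ideal.span {(p : R)}) R] {σ : R →+* R}

/-- Modulo `p` the matrix `β_(p ^ (s + 1))` is `Λ` times the twist of `β_(p ^ s)`, and `Λ` is
invertible because it reduces to `β_p`. -/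
theorem IsFrame.isUnit_hasseWitt_pow (h : IsFrame Δ μ b l) (hp : p.Prime) (hp2 : 2 < p)
    (hσ : ∀ r : R, (p : R) ∣ σ r - r ^ p) (hL : ∀ u, u ∈ L ↔ toReal u ∈ μ)
    (hg : Adapted Δ b l g) (hW : IsUnit (hasseWitt g L p)) (s : ℕ) :
    IsUnit (hasseWitt g L (p ^ s)) := by
  obtain ⟨Λ, hΛ, hΛ'⟩ := h.exists_cartier_matrix hp hp2 hσ hL hg hW
  induction s with
  | zero =>
    rw [pow_zero, hasseWitt_one]
    exact isUnit_one
  | succ s ih =>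
    refine isUnit_matrix_of_dvd_sub (p := p)
      ((isUnit_matrix_of_dvd_sub hW hΛ).mul (isUnit_hasseWitt_twist σ ih)) fun u v => ?_
    have := pow_dvd_hasseWitt_sub_mul hp hσ hg hΛ' (m := p ^ s) (pow_pos hp.pos s) 0 u v
    rw [zero_add, pow_one, pow_one, pow_zero, mul_one, ← pow_succ] at this
    rwa [← neg_sub, dvd_neg]

theorem IsFrame.exists_connection_matrix (h : IsFrame Δ μ b l) (hp : p.Prime) (hp2 : 2 < p)
    (hσ : ∀ r : R, (p : R) ∣ σ r - r ^ p) (hL : ∀ u, u ∈ L ↔ toReal u ∈ μ)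
    (hg : Adapted Δ b l g) (hW : IsUnit (hasseWitt g L p)) (δ : Derivation ℤ R R) :
    ∃ N : Matrix L L R, ∀ u : L, connectionHom δ (omega g b 1 (u : Fin n → ℤ)) -
      comb g b L (N u) ∈ dFormal R Δ b := by
  have h1 : ∀ u : L, connectionHom δ (omega g b 1 (u : Fin n → ℤ)) ∈ hat p g b μ := fun u =>
    h.connection_mem_hat δ hg (Omega_le_hat (omegaOne g b μ u ((hL u).mp u.2)).2)
  choose N hN using fun u => h.exists_sub_comb_mem_dFormal hp hp2 hσ hL hg hW (h1 u)
  exact ⟨Matrix.of N, hN⟩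

end Main

end

end UnitRoot

theorem theorem5p3 {R : Type*} [CommRing R] [IsDomain R] [CharZero R]
    (p : ℕ) (hp : p.Prime) (hp2 : 2 < p) [IsAdicComplete (Ideal.span {(p : R)}) R]
    (σ : R →+* R) (hσ : ∀ r : R, (p : R) ∣ σ r - r ^ p)
    {n : ℕ} (f : UnitRoot.Laurent R n) (b : Fin n → ℤ)
    (hb : UnitRoot.IsVertex (UnitRoot.newton f) b) (hfb : IsUnit (f.coeff b))
    (μ : Set (Fin n → ℝ)) (hμ : UnitRoot.IsFaceOpen (UnitRoot.newton f) μ)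
    (hμZ : (UnitRoot.lattice f μ).Nonempty)
    (hβ : IsUnit (UnitRoot.beta f μ p)) :
    (∀ s : ℕ, 1 ≤ s → IsUnit (UnitRoot.beta f μ (p ^ s))) ∧
    ∃ (B : Module.Basis (UnitRoot.lattice f μ) R
          (UnitRoot.Crystal p (UnitRoot.newton f) f b μ))
      (Bσ : Module.Basis (UnitRoot.lattice f μ) R
          (UnitRoot.Crystal p (UnitRoot.newton f) (UnitRoot.twist σ f) b μ)),
      (∀ u, B u = UnitRoot.omegaClass p (UnitRoot.newton f) f b μ u
          (UnitRoot.toReal_mem_of_lattice u)) ∧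
      (∀ u, Bσ u = UnitRoot.omegaClass p (UnitRoot.newton f) (UnitRoot.twist σ f) b μ u
          (UnitRoot.toReal_mem_of_lattice u)) ∧
      (∃ C : UnitRoot.Crystal p (UnitRoot.newton f) f b μ →ₗ[R]
            UnitRoot.Crystal p (UnitRoot.newton f) (UnitRoot.twist σ f) b μ,
        UnitRoot.IsInducedBy p (UnitRoot.newton f) f (UnitRoot.twist σ f) b μ
          (UnitRoot.cartier p) C ∧
        ∃ Λ : Matrix (UnitRoot.lattice f μ) (UnitRoot.lattice f μ) R,
          Λ.transpose = LinearMap.toMatrix B Bσ C ∧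
          (∀ u, C (B u) = ∑ w, Λ u w • Bσ w) ∧
          (∀ m s : ℕ, 1 ≤ m → 1 ≤ s →
            UnitRoot.MatCongr p s (UnitRoot.beta f μ (m * p ^ s))
              (Λ * (UnitRoot.beta f μ (m * p ^ (s - 1))).map σ)) ∧
          (∀ s : ℕ, 1 ≤ s →
            IsUnit ((UnitRoot.beta f μ (p ^ (s - 1))).map σ) ∧
            UnitRoot.MatCongr p s Λ
              (UnitRoot.beta f μ (p ^ s) * ((UnitRoot.beta f μ (p ^ (s - 1))).map σ)⁻¹))) ∧
      (∀ δ : Derivation ℤ R R,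
        ∃ D : UnitRoot.Crystal p (UnitRoot.newton f) f b μ →+
            UnitRoot.Crystal p (UnitRoot.newton f) f b μ,
          UnitRoot.IsInducedBy p (UnitRoot.newton f) f f b μ (UnitRoot.connection δ) D ∧
          ∃ N : Matrix (UnitRoot.lattice f μ) (UnitRoot.lattice f μ) R,
            (∀ u, D (B u) = ∑ w, N u w • B w) ∧
            (∀ N' : Matrix (UnitRoot.lattice f μ) (UnitRoot.lattice f μ) R,
              (∀ u, D (B u) = ∑ w, N' u w • B w) → N' = N) ∧
            (∀ m s : ℕ, 1 ≤ m → 1 ≤ s →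
              UnitRoot.MatCongr p s ((UnitRoot.beta f μ (m * p ^ s)).map δ)
                (N * UnitRoot.beta f μ (m * p ^ s))) ∧
            (∀ s : ℕ, 1 ≤ s →
              UnitRoot.MatCongr p s N
                ((UnitRoot.beta f μ (p ^ s)).map δ * (UnitRoot.beta f μ (p ^ s))⁻¹))) := by
  classical
  obtain ⟨l, h, hf⟩ := UnitRoot.exists_frame hb hfb hμ
  have hL := UnitRoot.mem_lattice hμ.1
  have hW : IsUnit (UnitRoot.hasseWitt f (UnitRoot.lattice f μ) p) := hβ
  have hfσ := hf.twist σ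
  have hWσ := UnitRoot.isUnit_hasseWitt_twist σ hW
  have hunit := h.isUnit_hasseWitt_pow hp hp2 hσ hL hf hW
  have hL' : ∀ u ∈ UnitRoot.lattice f μ, UnitRoot.toReal u ∈ μ := fun u hu => (hL u).mp hu
  obtain ⟨B, hB⟩ := h.exists_basis hp hp2 hσ hL hf hW
  obtain ⟨Bσ, hBσ⟩ := h.exists_basis hp hp2 hσ hL hfσ hWσ
  refine ⟨fun s _ => hunit s, B, Bσ, hB, hBσ, ?_, fun δ => ?_⟩
  · obtain ⟨Λ, -, hΛ⟩ := h.exists_cartier_matrix hp hp2 hσ hL hf hW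
    have hC : ∀ u, B.constr R (fun u => ∑ w, Λ u w • Bσ w) (B u) = ∑ w, Λ u w • Bσ w :=
      fun u => B.constr_basis R _ u
    have hcongr : ∀ m s : ℕ, 1 ≤ m → 1 ≤ s →
        UnitRoot.MatCongr p s (UnitRoot.beta f μ (m * p ^ s))
          (Λ * (UnitRoot.beta f μ (m * p ^ (s - 1))).map σ) := by
      intro m s hm hs u v
      obtain ⟨s, rfl⟩ := Nat.exists_eq_succ_of_ne_zero (Nat.one_le_iff_ne_zero.mp hs)
      have := UnitRoot.pow_dvd_hasseWitt_sub_mul hp hσ hf hΛ hm s u v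
      rwa [UnitRoot.hasseWitt_twist] at this
    have hunitσ : ∀ s, IsUnit ((UnitRoot.beta f μ (p ^ s)).map σ) := by
      intro s
      have := UnitRoot.isUnit_hasseWitt_twist σ (hunit s)
      rwa [UnitRoot.hasseWitt_twist] at this
    refine ⟨B.constr R (fun u => ∑ w, Λ u w • Bσ w), ?_, Λ, ?_, hC, hcongr, fun s hs =>
      ⟨hunitσ _, UnitRoot.MatCongr.mul_inv ?_ (hunitσ _)⟩⟩
    · refine UnitRoot.isInducedBy_of_coeff hL' hB hBσ
        (T := (UnitRoot.cartierHom R n p).toAddMonoidHom)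
        (fun F hF => h.cartier_mem_hat hp hp2 hσ hf hL hF)
        (fun F hF => UnitRoot.cartier_mem_dFormal hp hF) (fun a => Matrix.vecMul a Λ)
        (fun a => ?_) fun a => ?_
      · rw [map_sum, UnitRoot.sum_vecMul_smul]
        refine Finset.sum_congr rfl fun u _ => ?_
        rw [map_smul, hC]
      · rw [UnitRoot.comb_vecMul, UnitRoot.comb_apply, LinearMap.toAddMonoidHom_coe, map_sum,
          ← Finset.sum_sub_distrib]
        refine Submodule.sum_mem _ fun u _ => ?_
        obtain ⟨e, he, hu⟩ := hΛ u
        rw [map_smul, ← smul_sub, hu, add_sub_cancel_left]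
        exact Submodule.smul_mem _ _ (Submodule.smul_mem _ _ he)
    · ext w u
      rw [Matrix.transpose_apply, LinearMap.toMatrix_apply, hC, Bσ.repr_sum_self]
    · have := hcongr 1 s le_rfl hs
      rwa [one_mul, one_mul] at this
  · obtain ⟨N, hN⟩ := h.exists_connection_matrix hp hp2 hσ hL hf hW δ
    have hcongr := fun (m s : ℕ) (hm : 1 ≤ m) (_ : 1 ≤ s) =>
      UnitRoot.matCongr_connection hp hσ hf hN hm s
    -- A connection is only additive: by Leibniz its coordinates are those of `δ` applied to the
    -- coefficients plus the action of `N`.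
    let c : (UnitRoot.lattice f μ → R) → UnitRoot.lattice f μ → R :=
      fun a => (fun u => δ (a u)) + Matrix.vecMul a N
    let D : UnitRoot.Crystal p (UnitRoot.newton f) f b μ →+
        UnitRoot.Crystal p (UnitRoot.newton f) f b μ :=
      AddMonoidHom.mk' (fun x => ∑ w, c (B.repr x) w • B w) fun x y => by
        rw [← Finset.sum_add_distrib]
        refine Finset.sum_congr rfl fun w _ => ?_
        rw [← add_smul]
        congr 1
        simp only [c, map_add, Finsupp.coe_add, Matrix.add_vecMul, Pi.add_apply]
        abel
    have hDsum : ∀ a, D (∑ u, a u • B u) = ∑ w, c a w • B w := by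
      intro a
      change ∑ w, c (B.repr (∑ u, a u • B u)) w • B w = _
      rw [B.repr_sum_self]
    have hD : ∀ u, D (B u) = ∑ w, N u w • B w := by
      intro u
      have h1 := hDsum (Pi.single u 1)
      have h2 : c (Pi.single u 1) = N u := by
        ext w
        simp only [c, Pi.add_apply, Matrix.single_one_vecMul]
        rw [Pi.single_apply]
        split_ifs <;> simp
      rw [h2, Finset.sum_eq_single u] at h1
      · rwa [Pi.single_eq_same, one_smul] at h1
      · intro w _ hw
        rw [Pi.single_eq_of_ne hw, zero_smul]
      · simp
    refine ⟨D, ?_, N, hD, fun N' hN' => ?_, hcongr, fun s hs => UnitRoot.MatCongr.mul_inv ?_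
      (hunit s)⟩
    · refine UnitRoot.isInducedBy_of_coeff hL' hB hB (T := UnitRoot.connectionHom δ)
        (fun F hF => h.connection_mem_hat δ hf hF)
        (fun F hF => UnitRoot.connection_mem_dFormal δ hp hF) c hDsum fun a => ?_
      rw [map_add, UnitRoot.comb_vecMul, UnitRoot.comb_apply, UnitRoot.comb_apply, map_sum,
        ← Finset.sum_add_distrib, ← Finset.sum_sub_distrib]
      refine Submodule.sum_mem _ fun u _ => ?_
      rw [UnitRoot.connectionHom_smul, add_comm (a u • _), add_sub_add_left_eq_sub, ← smul_sub]
      exact Submodule.smul_mem _ _ (hN u)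
    · ext u w
      have h1 := congrArg (fun x => B.repr x w) ((hN' u).symm.trans (hD u))
      simpa only [B.repr_sum_self] using h1
    · have := hcongr 1 s le_rfl hs
      rwa [one_mul] at this
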